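/- Let $L$ be a finite set of binary, symmetric, irreflexive relation symbols ("colours"). An $L$-structure is complete if any two distinct elements $a,b$ are related by exactly one relation, denoted $\mathbf r(a,b)$; a triangle is a complete structure on three points. Let $S$ be a set of triangles, and let $Forb_c(S)$ be the class of finite complete $L$-structures that embed no triangle from $S$. Let $L'=\{R_1,\dots,R_m\}\subsetneq L$, ordered by $R_1>\cdots>R_m$. For $A,B,C\in Forb_c(S)$ with $B\subseteq A,C$, the prioritised amalgam $A\otimes_B C$ is the structure on the disjoint union of $A$ and $C$ over $B$ that extends $A$ and $C$ and in which, for $a\in A\setminus B$ and $c\in C\setminus B$, $\mathbf r(a,c)=R_i$, where $i$ is the least index such that for no $b\in B$ the triangle with edge colours $\mathbf r(a,b),\mathbf r(b,c),R_i$ belongs to $S$ up to isomorphism. Suppose that $Forb_c(S)$ is a prioritised semi-free amalgamation class with respect to this ordering, that is, for all such $A,B,C$ the amalgam $A\otimes_B C$ is defined (such an $i$ always exists) and belongs to $Forb_c(S)$. Let $M_S$ be the (countable) Fraïssé limit of $Forb_c(S)$. For finite $A,B,C\subseteq M_S$, write $A\perp_B C$ if the substructure of $M_S$ on $A\cup B\cup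 C$ is $(A\cup B)\otimes_B(B\cup C)$; in particular this requires $(A\cup B)\cap(B\cup C)=B$. Suppose moreover that: (i) no triangle in $S$ has two edges coloured $R_1$, and (if $m\ge 2$) none has an edge coloured $R_1$ and an edge coloured $R_2$; (ii) for all $a,b,c\in M_S$ with $a\neq b$ and $c\ne b$ and all finite $B\subseteq M_S$: if $\mathbf r(a,b)\in L'$ and $a\perp_{\{b\}\cup B}c$, then $a\perp_B c$. Then $\mathrm{Aut}(M_S)$ is a simple group. Moreover, for every $g\in\mathrm{Aut}(M_S)$ with $g\neq 1$, every element of $\mathrm{Aut}(M_S)$ is a product of 64 elements, each of which is a conjugate of $g$ or of $g^{-1}$. -/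

import Mathlib

open scoped FirstOrder
open CategoryTheory

universe u w

/-- The relation symbols of the language with one binary relation symbol for every colour in `Λ`. -/
inductive ColourRel (Λ : Type u) : ℕ → Type u
  | colour (p : Λ) : ColourRel Λ 2

/-- The relational language with one binary relation symbol for every colour in `Λ`. -/
def colourLanguage (Λ : Type u) : FirstOrder.Language.{0, u} := ⟨fun _ => Empty, ColourRel Λ⟩

instance colourLanguage_isRelational (Λ : Type u) : (colourLanguage Λ).IsRelational :=
  fun _ => inferInstanceAs (IsEmpty Empty)

/-- The automorphism group of a first-order structure; multiplication is composition. -/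
instance structureAutGroup {L : FirstOrder.Language} (M : Type*) [L.Structure M] : Group (M ≃[L] M) where
  mul f g := f.comp g
  one := FirstOrder.Language.Equiv.refl L M
  inv f := f.symm
  mul_assoc f g h := FirstOrder.Language.Equiv.comp_assoc h g f
  one_mul f := FirstOrder.Language.Equiv.refl_comp f
  mul_one f := FirstOrder.Language.Equiv.comp_refl f
  inv_mul_cancel f := FirstOrder.Language.Equiv.symm_comp_self f

section Coloured

variable {Λ : Type u}

/-- The binary relation symbol of the colour `p`. -/
def colourSymbol (p : Λ) : (colourLanguage Λ).Relations 2 := ColourRel.colour p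

/-- The pair `(x, y)` is in the relation `p`. -/
def HasColour {A : Type*} [(colourLanguage Λ).Structure A] (p : Λ) (x y : A) : Prop :=
  FirstOrder.Language.Structure.RelMap (colourSymbol p) ![x, y]

/-- Complete structures: all relations are symmetric and irreflexive, and any two distinct elements
are related by exactly one relation. -/
structure IsCompleteStructure (Λ : Type u) (A : Type*) [(colourLanguage Λ).Structure A] :
    Prop where
  symm : ∀ (p : Λ) (x y : A), HasColour p x y → HasColour p y x
  irrefl : ∀ (p : Λ) (x : A), ¬ HasColour p x x
  existsUnique : ∀ x y : A, x ≠ y → ∃! p : Λ, HasColour p x y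

/-- A triangle is a complete structure on three points. -/
def IsTriangle (T : Bundled.{w} (colourLanguage Λ).Structure) : Prop :=
  IsCompleteStructure Λ T ∧ Nat.card T = 3

/-- The class `Forb_c(S)` of the finite complete structures that embed no member of `S`. -/
def forbC (S : Set (Bundled.{w} (colourLanguage Λ).Structure)) :
    Set (Bundled.{w} (colourLanguage Λ).Structure) :=
  {A | Finite A ∧ IsCompleteStructure Λ A ∧ ∀ T ∈ S, IsEmpty (T ↪[colourLanguage Λ] A)}

/-- Up to isomorphism, the triangle whose three edges have colours `p`, `q`, `s` is in `S`. -/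
def IsForbiddenTriangle (S : Set (Bundled.{w} (colourLanguage Λ).Structure)) (p q s : Λ) : Prop :=
  ∃ T ∈ S, ∃ x y z : T, x ≠ y ∧ y ≠ z ∧ x ≠ z ∧
    HasColour p x y ∧ HasColour q y z ∧ HasColour s x z

/-- Colouring `(a, c)` by `p` forms no forbidden triangle `a b c` with `b ∈ B`. -/
def IsPermitted (S : Set (Bundled.{w} (colourLanguage Λ).Structure))
    {D : Type*} [(colourLanguage Λ).Structure D] (B : Set D) (a c : D) (p : Λ) : Prop :=
  ∀ b ∈ B, ∀ q s : Λ, HasColour q a b → HasColour s b c → ¬ IsForbiddenTriangle S q s p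

/-- Inside the structure `D`, where `B ⊆ A` and `B ⊆ C`, the substructure on `A ∪ C` is the
prioritised amalgam `A ⊗_B C` for the ordered list of solutions `R 0 > R 1 > ⋯`: the sets `A` and
`C` meet in `B` only, and each pair `(a, c)` in `(A \ B) × (C \ B)` has the first colour on the list
that forms no forbidden triangle with a point of `B`. -/
def IsPrioritisedIn (S : Set (Bundled.{w} (colourLanguage Λ).Structure)) {m : ℕ} (R : Fin m → Λ)
    {D : Type*} [(colourLanguage Λ).Structure D] (A B C : Set D) : Prop :=
  A ∩ C = B ∧ ∀ a ∈ A \ B, ∀ c ∈ C \ B, ∃ i : Fin m,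
    IsPermitted S B a c (R i) ∧ (∀ j < i, ¬ IsPermitted S B a c (R j)) ∧ HasColour (R i) a c

/-- `Forb_c(S)` is a prioritised semi-free amalgamation class with respect to the set of
solutions `L' = {R 0, …, R (m - 1)}`, a proper subset of the language, ordered by
`R 0 > R 1 > ⋯ > R (m - 1)`: for all `B ⊆ A, C` in `Forb_c(S)` the prioritised amalgam `A ⊗_B C`
is defined and lies in `Forb_c(S)`. -/
structure IsPrioritisedClass (S : Set (Bundled.{w} (colourLanguage Λ).Structure)) {m : ℕ}
    (R : Fin m → Λ) : Prop where
  injective : Function.Injective R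
  proper : ¬ Function.Surjective R
  amalgam : ∀ A B C : Bundled.{w} (colourLanguage Λ).Structure,
    A ∈ forbC S → B ∈ forbC S → C ∈ forbC S →
    ∀ (f₁ : B ↪[colourLanguage Λ] A) (f₂ : B ↪[colourLanguage Λ] C),
    ∃ D ∈ forbC S, ∃ (g₁ : A ↪[colourLanguage Λ] D) (g₂ : C ↪[colourLanguage Λ] D),
      (∀ b, g₁ (f₁ b) = g₂ (f₂ b)) ∧ Set.range g₁ ∪ Set.range g₂ = Set.univ ∧
      IsPrioritisedIn S R (Set.range g₁) (Set.range fun b => g₁ (f₁ b)) (Set.range g₂)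

/-- The relation `A ⫝_B C` between finite subsets of `M`, i.e. `ABC = AB ⊗_B BC`. -/
def Indep (S : Set (Bundled.{w} (colourLanguage Λ).Structure)) {m : ℕ} (R : Fin m → Λ)
    {M : Type*} [(colourLanguage Λ).Structure M] (A B C : Set M) : Prop :=
  IsPrioritisedIn S R (A ∪ B) B (B ∪ C)

/-- Some triangle in `S` has an edge of colour `p` and another edge of colour `q`. -/
def InvolvesPair (S : Set (Bundled.{w} (colourLanguage Λ).Structure)) (p q : Λ) : Prop :=
  ∃ s : Λ, IsForbiddenTriangle S p q s

/-- The two-part condition on the set `S` of forbidden triangles, with respect to the ordered set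
of solutions `R 0 > R 1 > ⋯ > R (m - 1)` and the Fraïssé limit `M` of `Forb_c(S)`. -/
structure MainCondition (S : Set (Bundled.{w} (colourLanguage Λ).Structure)) {m : ℕ}
    (R : Fin m → Λ) (M : Type*) [(colourLanguage Λ).Structure M] : Prop where
  /-- No triangle in `S` involves the first colour twice, or the first and the second colour. -/
  no_pair : ∀ i j : Fin m, i.val = 0 → j.val ≤ 1 → ¬ InvolvesPair S (R i) (R j)
  /-- If `a ⫝_{bB} c` and the colour of `(a, b)` is in `L'`, then `a ⫝_B c`. -/
  delete : ∀ (a b c : M) (B : Set M), B.Finite → c ≠ b → (∃ i : Fin m, HasColour (R i) a b) →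
    Indep S R {a} (insert b B) {c} → Indep S R {a} B {c}

end Coloured

/-!
The proof separates a general part, on stationary independence relations in the style of Tent and
Ziegler, from the study of the Fraïssé limit `M`.

Independence in `M` is determined by pairs of points, so it is treated as a relation `I B a c`
between points. The colours between the two parts of a prioritised amalgam only depend on the
colours to the base, and the amalgam exists in the class. This gives `stationaryIndep_limit`:
independence is invariant, symmetric and monotone in the base, every finite set has an independent
copy, and this copy is unique up to conjugation. Transitivity follows.

If `k` moves maximally, so that every type over a finite set has a realisation that is as
independent from its image as possible, then every `f` in the group is `w w'⁻¹` for products `w` and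
`w'` of four conjugates of `k` (`MovesMaximally.exists_conjChain`). Both products are built from
finite approximations, with `w = f w'` on a growing finite set. An approximation of a product of
four conjugates can be made good (`exists_isGood`), and a good one can follow any extension of the
value of the product (`IsGood.exists_conj_eq`). So the two sides can alternate: one extends its
approximation to a good one, the other follows, and the roles are exchanged.

It remains to find a product of few conjugates of `g ≠ 1` that moves maximally. A colour `P`, the
first solution, and a colour `t` that no forbidden triangle combines with `P` are used to see that
`g` moves a realisation of every type of a new point (`movesPoints_of_ne_one`). Take the commutator
`φ⁻¹k⁻¹φk` of `φ = g` with a generic `k`: for a realisation `a` of a type, `w = k⁻¹φk a` can be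
chosen independent from `φ a` over a set that contains neither of them, so the colour between them
is a solution, and so is the colour between the image `φ⁻¹ w` of `a` and `a` itself
(`MovesPoints.exists_commutator`). Repeat this with the commutator in place of `φ`. Now the colour
between `a` and `w` is a solution, and `w` is independent from `φ a` over `A ∪ {a}` for a finite set
`A`; the hypothesis on deleting points from the base removes `a`, and what is left is that the new
commutator moves maximally (`MovesPoints.exists_commutator_movesMaximally`). It is a product of four
conjugates of `g` and `g⁻¹`, so 32 conjugates suffice for any `f`, and `f = f * 1` uses 64.
-/

open scoped Pointwise

/-! ### Stationary independence relations -/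

section Independence

variable {G M : Type*} [Group G] [MulAction G M]

/-- A stationary independence relation for the action of `G` on `M`, given on points: `I B a c`
says that `a` and `c` are independent over `B`, and finite sets `A`, `C` are independent over `B`
when all pairs of points of `A` and `C` are. -/
structure StationaryIndep (G : Type*) {M : Type*} [Group G] [MulAction G M]
    (I : Set M → M → M → Prop) : Prop where
  smul : ∀ (g : G) (B : Set M) (a c : M), I B a c → I (g • B) (g • a) (g • c)
  symm : ∀ (B : Set M) (a c : M), I B a c → I B c a
  mono : ∀ (B B' : Set M) (a c : M), B ⊆ B' → I B a c → I B' a c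
  of_mem : ∀ (B : Set M) (a c : M), a ∈ B → I B a c
  mem_of_self : ∀ (B : Set M) (a : M), I B a a → a ∈ B
  /-- Every finite set has a copy over `B` that is independent from `C`. -/
  exist : ∀ A B C : Set M, A.Finite → B.Finite → C.Finite →
    ∃ g : G, (∀ b ∈ B, g • b = b) ∧ ∀ a ∈ A, ∀ c ∈ C, I B (g • a) c
  /-- Any two such copies are conjugate over `B ∪ C`. -/
  stat : ∀ (A B C : Set M) (g : G), A.Finite → B.Finite → C.Finite → (∀ b ∈ B, g • b = b) →
    (∀ a ∈ A, ∀ c ∈ C, I B a c) → (∀ a ∈ A, ∀ c ∈ C, I B (g • a) c) →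
    ∃ g' : G, (∀ b ∈ B, g' • b = b) ∧ (∀ c ∈ C, g' • c = c) ∧ ∀ a ∈ A, g' • a = g • a

theorem smul_set_eq_of_forall {g h : G} {X : Set M} (H : ∀ x ∈ X, g • x = h • x) :
    g • X = h • X :=
  Set.image_congr H

theorem smul_set_eq_self {g : G} {X : Set M} (H : ∀ x ∈ X, g • x = x) : g • X = X := by
  rw [smul_set_eq_of_forall (h := 1) (by simpa using H), one_smul]

theorem inv_smul_eq_self {g : G} {x : M} (H : g • x = x) : g⁻¹ • x = x := by
  rw [inv_smul_eq_iff, H]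

variable {I : Set M → M → M → Prop}

namespace StationaryIndep

theorem smul_iff (hI : StationaryIndep G I) {g : G} {B : Set M} {a c : M} :
    I (g • B) (g • a) (g • c) ↔ I B a c :=
  ⟨fun h => by simpa using hI.smul g⁻¹ _ _ _ h, hI.smul g B a c⟩

/-- Invariance under an element that fixes the base. -/
theorem smul_of_fix (hI : StationaryIndep G I) {g : G} {B : Set M} {a c : M}
    (hg : ∀ b ∈ B, g • b = b) (h : I B a c) : I B (g • a) (g • c) := by
  have := hI.smul g B a c h
  rwa [smul_set_eq_self hg] at this

theorem of_mem_right (hI : StationaryIndep G I) {B : Set M} {a c : M} (h : c ∈ B) : I B a c :=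
  hI.symm _ _ _ (hI.of_mem _ _ _ h)

/-- Transitivity: a copy of `a` over `B` that is independent from `C ∪ {d}` is conjugate to `a`
over `B ∪ C`, and then over `B ∪ C ∪ {d}`, by stationarity. -/
theorem trans (hI : StationaryIndep G I) {B C : Set M} (hB : B.Finite) (hC : C.Finite) {a d : M}
    (h₁ : ∀ c ∈ C, I B a c) (h₂ : I (B ∪ C) a d) : I B a d := by
  obtain ⟨σ, hσB, hσ⟩ := hI.exist {a} B (C ∪ {d}) (Set.finite_singleton a) hB
    (hC.union (Set.finite_singleton d))
  obtain ⟨σ₁, h1B, h1C, h1a⟩ := hI.stat {a} B C σ (Set.finite_singleton a) hB hC hσB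
    (by simpa using h₁) (fun x hx c hc => hσ x hx c (Or.inl hc))
  simp only [Set.mem_singleton_iff, forall_eq] at hσ h1a
  have h1 : ∀ b ∈ B ∪ C, σ₁ • b = b := fun b hb => hb.elim (h1B b) (h1C b)
  obtain ⟨σ₂, h2B, h2d, h2a⟩ := hI.stat {a} (B ∪ C) {d} σ₁ (Set.finite_singleton a)
    (hB.union hC) (Set.finite_singleton d) h1 (by simpa using h₂)
    (by simpa [h1a] using hI.mono _ _ _ _ Set.subset_union_left (hσ d (Or.inr rfl)))
  simp only [Set.mem_singleton_iff, forall_eq] at h2d h2a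
  have h3 : I (σ₂ • B) (σ₂ • a) (σ₂ • d) := by
    rw [h2d, h2a, h1a, smul_set_eq_self fun b hb => h2B b (Or.inl hb)]
    exact hσ d (Or.inr rfl)
  exact hI.smul_iff.1 h3

/-- Transitivity with an arbitrary second base that is covered by `B ∪ C`. -/
theorem trans_of_subset (hI : StationaryIndep G I) {B C D : Set M} (hB : B.Finite) (hC : C.Finite)
    {a d : M} (hD : D ⊆ B ∪ C) (h₁ : ∀ c ∈ C, I B a c) (h₂ : I D a d) : I B a d :=
  hI.trans hB hC h₁ (hI.mono _ _ _ _ hD h₂)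

end StationaryIndep

/-! ### Elements that move types maximally -/

/-- `k` moves maximally: every type of a finite tuple over a finite set `X` has a realisation `x`
such that `x` is independent from `kX ∪ k x` over `X`, and `k x` from `X ∪ x` over `kX`. Here the
type is that of an enumeration of `Z`, and `x` is its translate by `b`. -/
def MovesMaximally (I : Set M → M → M → Prop) (k : G) : Prop :=
  ∀ X Z : Set M, X.Finite → Z.Finite → ∃ b : G, (∀ x ∈ X, b • x = x) ∧
    (∀ z ∈ Z, ∀ x ∈ X, I X (b • z) (k • x)) ∧ (∀ z ∈ Z, ∀ z' ∈ Z, I X (b • z) (k • b • z')) ∧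
    (∀ z ∈ Z, ∀ x ∈ X, I (k • X) (k • b • z) x) ∧
    (∀ z ∈ Z, ∀ z' ∈ Z, I (k • X) (k • b • z) (b • z'))

theorem MovesMaximally.inv {k : G} (hk : MovesMaximally I k) :
    MovesMaximally I k⁻¹ := by
  intro X Z hX hZ
  obtain ⟨b, hb, h1, h2, h3, h4⟩ := hk (k⁻¹ • X) (k⁻¹ • Z) hX.smul_set hZ.smul_set
  have hs : ∀ {Y : Set M} {x : M}, x ∈ Y → k⁻¹ • x ∈ k⁻¹ • Y := fun h => Set.smul_mem_smul_set h
  refine ⟨k * b * k⁻¹, ?_, ?_, ?_, ?_, ?_⟩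
  · intro x hx
    rw [mul_smul, mul_smul, hb _ (hs hx), smul_inv_smul]
  · intro z hz x hx
    simpa [mul_smul] using h3 _ (hs hz) _ (hs hx)
  · intro z hz z' hz'
    simpa [mul_smul] using h4 _ (hs hz) _ (hs hz')
  · intro z hz x hx
    simpa [mul_smul] using h1 _ (hs hz) _ (hs hx)
  · intro z hz z' hz'
    simpa [mul_smul] using h2 _ (hs hz) _ (hs hz')

theorem MovesMaximally.conj (hI : StationaryIndep G I) {k : G} (hk : MovesMaximally I k) (e : G) :
    MovesMaximally I (e * k * e⁻¹) := by
  intro X Z hX hZ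
  obtain ⟨b, hb, h1, h2, h3, h4⟩ := hk (e⁻¹ • X) (e⁻¹ • Z) hX.smul_set hZ.smul_set
  have hs : ∀ {Y : Set M} {x : M}, x ∈ Y → e⁻¹ • x ∈ e⁻¹ • Y := fun h => Set.smul_mem_smul_set h
  refine ⟨e * b * e⁻¹, ?_, ?_, ?_, ?_, ?_⟩
  · intro x hx
    rw [mul_smul, mul_smul, hb _ (hs hx), smul_inv_smul]
  · intro z hz x hx
    simpa [mul_smul] using hI.smul e _ _ _ (h1 _ (hs hz) _ (hs hx))
  · intro z hz z' hz'
    simpa [mul_smul] using hI.smul e _ _ _ (h2 _ (hs hz) _ (hs hz'))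
  · intro z hz x hx
    simpa [mul_smul] using hI.smul e _ _ _ (h3 _ (hs hz) _ (hs hx))
  · intro z hz z' hz'
    simpa [mul_smul] using hI.smul e _ _ _ (h4 _ (hs hz) _ (hs hz'))

/-- It is enough to move the types of single points maximally: the points of a tuple are treated one
after the other, each over the base enlarged by the previous ones. -/
theorem movesMaximally_of_point (hI : StationaryIndep G I) {k : G}
    (hk : ∀ X : Set M, X.Finite → ∀ a₀ : M, ∃ σ : G, (∀ x ∈ X, σ • x = x) ∧
      (∀ x ∈ X, I X (σ • a₀) (k • x)) ∧ I X (σ • a₀) (k • σ • a₀) ∧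
      (∀ x ∈ X, I (k • X) (k • σ • a₀) x) ∧ I (k • X) (k • σ • a₀) (σ • a₀)) :
    MovesMaximally I k := by
  intro X Z hX hZ
  induction Z, hZ using Set.Finite.induction_on with
  | empty => exact ⟨1, by simp⟩
  | @insert a₀ Z _ hZ ih =>
    obtain ⟨b, hb, h1, h2, h3, h4⟩ := ih
    have hbZ : (b • Z).Finite := hZ.smul_set
    have hkX : (k • X).Finite := hX.smul_set
    have hkZ : (k • b • Z).Finite := hbZ.smul_set
    have mZ : ∀ z ∈ Z, b • z ∈ b • Z := fun z hz => Set.smul_mem_smul_set hz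
    obtain ⟨σ, hσ, s1, s2, s3, s4⟩ := hk (X ∪ b • Z) (hX.union hbZ) (b • a₀)
    have hkU : k • (X ∪ b • Z) = k • X ∪ k • b • Z := Set.smul_set_union
    rw [hkU] at s3 s4
    have hσZ : ∀ z ∈ Z, σ • b • z = b • z := fun z hz => hσ _ (Or.inr (mZ z hz))
    set a := σ • b • a₀ with ha
    -- the old points are independent from the image of the new one, and conversely
    have t1 : ∀ z ∈ Z, I X (b • z) (k • a) := fun z hz =>
      hI.trans_of_subset hX (hkX.union hkZ) Set.subset_union_right
        (by
          rintro c (⟨x, hx, rfl⟩ | ⟨_, ⟨z', hz', rfl⟩, rfl⟩)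
          exacts [h1 z hz x hx, h2 z hz z' hz'])
        (hI.symm _ _ _ (s3 _ (Or.inr (mZ z hz))))
    have t2 : ∀ t, (∀ z ∈ Z, I X t (b • z)) → I (X ∪ b • Z) a t → I X a t := fun t ht h =>
      hI.symm _ _ _ (hI.trans hX hbZ (by rintro _ ⟨z, hz, rfl⟩; exact ht z hz) (hI.symm _ _ _ h))
    have u1 : ∀ z ∈ Z, I (k • X) (k • b • z) a := fun z hz =>
      hI.trans_of_subset hkX (hX.union hbZ) Set.subset_union_right
        (by
          rintro c (hx | ⟨z', hz', rfl⟩)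
          exacts [h3 z hz _ hx, h4 z hz z' hz'])
        (hI.symm _ _ _ (s1 _ (Or.inr (mZ z hz))))
    have u2 : ∀ t, (∀ z ∈ Z, I (k • X) t (k • b • z)) → I (k • X ∪ k • b • Z) (k • a) t →
        I (k • X) (k • a) t := fun t ht h =>
      hI.symm _ _ _ (hI.trans hkX hkZ
        (by rintro _ ⟨_, ⟨z, hz, rfl⟩, rfl⟩; exact ht z hz) (hI.symm _ _ _ h))
    simp only [Set.forall_mem_insert]
    refine ⟨σ * b, ?_, ⟨?_, ?_⟩, ⟨⟨?_, ?_⟩, ?_⟩, ⟨?_, ?_⟩, ⟨⟨?_, ?_⟩, ?_⟩⟩ <;>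
      simp only [mul_smul, ← ha]
    · intro x hx
      rw [hb x hx, hσ x (Or.inl hx)]
    · intro x hx
      exact t2 _ (fun z hz => hI.symm _ _ _ (h1 z hz x hx)) (s1 x (Or.inl hx))
    · intro z hz x hx
      rw [hσZ z hz]
      exact h1 z hz x hx
    · exact t2 _ (fun z hz => hI.symm _ _ _ (t1 z hz)) s2
    · intro z hz
      rw [hσZ z hz]
      exact t2 _ (fun z' hz' => hI.symm _ _ _ (h2 z' hz' z hz)) (s1 _ (Or.inr (mZ z hz)))
    · intro z hz
      rw [hσZ z hz]
      refine ⟨t1 z hz, fun z' hz' => ?_⟩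
      rw [hσZ z' hz']
      exact h2 z hz z' hz'
    · intro x hx
      exact u2 _ (fun z hz => hI.symm _ _ _ (h3 z hz x hx)) (s3 x (Or.inl hx))
    · intro z hz x hx
      rw [hσZ z hz]
      exact h3 z hz x hx
    · exact u2 _ (fun z hz => hI.symm _ _ _ (u1 z hz)) s4
    · intro z hz
      rw [hσZ z hz]
      exact u2 _ (fun z' hz' => hI.symm _ _ _ (h4 z' hz' z hz)) (s3 _ (Or.inr (mZ z hz)))
    · intro z hz
      rw [hσZ z hz]
      refine ⟨u1 z hz, fun z' hz' => ?_⟩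
      rw [hσZ z' hz']
      exact h4 z hz z' hz'

/-! ### Realising prescribed images by conjugates -/

/-- If `σ` agrees with `k` on `X`, if `Z` is independent from `kX` over `X`, and if `σ Z` is
independent from `X ∪ Z` over `kX`, then a conjugate of
`k` by an element fixing `X` and `kX` agrees with `σ` on `Z`. -/
theorem MovesMaximally.exists_conj_eq (hI : StationaryIndep G I) {k : G} (hk : MovesMaximally I k)
    {X Z : Set M} (hX : X.Finite) (hZ : Z.Finite) {σ : G} (hσ : ∀ x ∈ X, σ • x = k • x)
    (h₁ : ∀ z ∈ Z, ∀ x ∈ X, I X z (k • x)) (h₂ : ∀ z ∈ Z, ∀ x ∈ X, I (k • X) (σ • z) x)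
    (h₃ : ∀ z ∈ Z, ∀ z' ∈ Z, I (k • X) (σ • z) z') :
    ∃ a : G, (∀ x ∈ X, a • x = x) ∧ (∀ x ∈ X, a • k • x = k • x) ∧
      ∀ z ∈ Z, (a * k * a⁻¹) • z = σ • z := by
  obtain ⟨b, hb, b1, -, b3, b4⟩ := hk X Z hX hZ
  have hkX : (k • X).Finite := hX.smul_set
  have hbi : ∀ x ∈ X, b⁻¹ • x = x := fun x hx => inv_smul_eq_self (hb x hx)
  have hki : ∀ x ∈ X, σ⁻¹ • k • x = x := fun x hx => by rw [← hσ x hx, inv_smul_smul]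
  -- move `b Z` back to `Z`, over `X ∪ kX`
  obtain ⟨c, cX, ckX, cZ⟩ := hI.stat (b • Z) X (k • X) b⁻¹ hZ.smul_set hX hkX hbi
    (by rintro _ ⟨z, hz, rfl⟩ _ ⟨x, hx, rfl⟩; exact b1 z hz x hx)
    (by rintro _ ⟨z, hz, rfl⟩ _ ⟨x, hx, rfl⟩; simpa using h₁ z hz x hx)
  have cZ' : ∀ z ∈ Z, c • b • z = z := fun z hz => by
    rw [cZ _ (Set.smul_mem_smul_set hz), inv_smul_smul]
  have ckX' : ∀ x ∈ X, c • k • x = k • x := fun x hx => ckX _ (Set.smul_mem_smul_set hx)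
  have cki : ∀ x ∈ X, c⁻¹ • k • x = k • x := fun x hx => inv_smul_eq_self (ckX' x hx)
  -- then move the new image of `Z` to `σ Z`, over `kX ∪ X ∪ Z`
  obtain ⟨d, dkX, dXZ, dZ⟩ := hI.stat ((c * k * b) • Z) (k • X) (X ∪ Z) (σ * b⁻¹ * k⁻¹ * c⁻¹)
    hZ.smul_set hkX (hX.union hZ)
    (by
      rintro _ ⟨x, hx, rfl⟩
      simp only [mul_smul]
      rw [cki x hx, inv_smul_smul, hbi x hx, hσ x hx])
    (by
      rintro _ ⟨z, hz, rfl⟩ y hy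
      simp only [mul_smul]
      have hcb : ∀ y ∈ k • X, c • y = y := ckX
      rcases hy with hy | hy
      · simpa [cX y hy] using hI.smul_of_fix hcb (b3 z hz y hy)
      · simpa [cZ' y hy] using hI.smul_of_fix hcb (b4 z hz y hy))
    (by
      rintro _ ⟨z, hz, rfl⟩ y hy
      simp only [mul_smul, inv_smul_smul]
      exact hy.elim (h₂ z hz y) (h₃ z hz y))
  refine ⟨d * c, ?_, ?_, ?_⟩
  · intro x hx
    rw [mul_smul, cX x hx, dXZ x (Or.inl hx)]
  · intro x hx
    rw [mul_smul, ckX' x hx, dkX _ (Set.smul_mem_smul_set hx)]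
  · intro z hz
    have h5 : c⁻¹ • z = b • z := by rw [inv_smul_eq_iff, cZ' z hz]
    have h6 := dZ ((c * k * b) • z) (Set.smul_mem_smul_set hz)
    simp only [mul_smul, inv_smul_smul, mul_inv_rev] at h6 ⊢
    rw [inv_smul_eq_self (dXZ z (Or.inr hz)), h5, h6]

/-- If `E` is independent from `X` over `kX`, then `k` has a conjugate by an element fixing `X` and
`kX` that maps a given finite set `Z` to a set independent from `E` over `kX`. No condition relates
`Z` with `kX` or `E`. -/
theorem MovesMaximally.exists_conj_indep (hI : StationaryIndep G I) {k : G}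
    (hk : MovesMaximally I k) {X Z E : Set M} (hX : X.Finite) (hZ : Z.Finite) (hE : E.Finite)
    (hXE : ∀ x ∈ X, ∀ y ∈ E, I (k • X) x y) :
    ∃ a : G, (∀ x ∈ X, a • x = x) ∧ (∀ x ∈ X, a • k • x = k • x) ∧
      ∀ z ∈ Z, ∀ y ∈ E, I (k • X) ((a * k * a⁻¹) • z) y := by
  have hkX : (k • X).Finite := hX.smul_set
  have mkX : ∀ x ∈ X, k • x ∈ k • X := fun x hx => Set.smul_mem_smul_set hx
  set W := X ∪ k • X with hW
  have hWf : W.Finite := hX.union hkX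
  -- first make the image of `kX` independent from `Z ∪ E` over `W`
  obtain ⟨c₀, c0W, hc0⟩ := hI.exist (k • k • X) W (Z ∪ E) hkX.smul_set hWf (hZ.union hE)
  have c0i : ∀ x ∈ W, c₀⁻¹ • x = x := fun x hx => inv_smul_eq_self (c0W x hx)
  set k₀ := c₀ * k * c₀⁻¹ with hk₀
  have k0X : ∀ x ∈ X, k₀ • x = k • x := fun x hx => by
    rw [hk₀, mul_smul, mul_smul, c0i x (Or.inl hx), c0W _ (Or.inr (mkX x hx))]
  have k0kX : ∀ x ∈ X, k₀ • k • x = c₀ • k • k • x := fun x hx => by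
    rw [hk₀, mul_smul, mul_smul, c0i _ (Or.inr (mkX x hx))]
  set V := k₀ • W with hV
  have hVf : V.Finite := hWf.smul_set
  have VX : ∀ x ∈ X, k • x ∈ V := fun x hx => ⟨x, Or.inl hx, k0X x hx⟩
  have hVE : ∀ v ∈ V, ∀ y ∈ Z ∪ E, I W y v := by
    rintro _ ⟨x, hx | ⟨x, hx, rfl⟩, rfl⟩ y hy
    · simp only [k0X x hx]
      exact hI.of_mem_right (Or.inr (mkX x hx))
    · simp only [k0kX x hx]
      exact hI.symm _ _ _ (hc0 _ (Set.smul_mem_smul_set (mkX x hx)) y hy)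
  -- then move `Z` maximally over `W`, and carry the realisation found back to `Z`
  obtain ⟨b, hb, h1, -, h3, h4⟩ := hk.conj hI c₀ W Z hWf hZ
  rw [← hk₀] at h1 h3 h4
  obtain ⟨c, cW, cV, cZ⟩ := hI.stat (b • Z) W V b⁻¹ hZ.smul_set hWf hVf
    (fun x hx => inv_smul_eq_self (hb x hx))
    (by rintro _ ⟨z, hz, rfl⟩ _ ⟨x, hx, rfl⟩; exact h1 z hz x hx)
    (by
      rintro _ ⟨z, hz, rfl⟩ v hv
      simpa using hVE v hv z (Or.inl hz))
  have cZ' : ∀ z ∈ Z, c • b • z = z := fun z hz => by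
    rw [cZ _ (Set.smul_mem_smul_set hz), inv_smul_smul]
  have cZi : ∀ z ∈ Z, c⁻¹ • z = b • z := fun z hz => by rw [inv_smul_eq_iff, cZ' z hz]
  -- finally make the image of `Z` independent from `E`
  obtain ⟨d, hd, hdE⟩ := hI.exist ((c * k₀ * b) • Z) (W ∪ Z ∪ V) E hZ.smul_set
    ((hWf.union hZ).union hVf) hE
  have hdi : ∀ x ∈ W ∪ Z ∪ V, d⁻¹ • x = x := fun x hx => inv_smul_eq_self (hd x hx)
  have key : ∀ z ∈ Z, (d * c * c₀ * k * (d * c * c₀)⁻¹) • z = d • (c * k₀ * b) • z := by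
    intro z hz
    simp only [hk₀, mul_inv_rev, mul_smul]
    rw [hdi z (Or.inl (Or.inr hz)), cZi z hz]
  refine ⟨d * c * c₀, ?_, ?_, ?_⟩
  · intro x hx
    rw [mul_smul, mul_smul, c0W x (Or.inl hx), cW x (Or.inl hx), hd x (Or.inl (Or.inl (Or.inl hx)))]
  · intro x hx
    have := mkX x hx
    rw [mul_smul, mul_smul, c0W _ (Or.inr this), cW _ (Or.inr this),
      hd _ (Or.inl (Or.inl (Or.inr this)))]
  · intro z hz y hy
    rw [key z hz]
    set z₁ := d • (c * k₀ * b) • z with hz₁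
    have hcV : ∀ v ∈ V, c • v = v := cV
    have i1 : ∀ t ∈ W ∪ Z, I V z₁ t := by
      intro t ht
      have : I V ((c * k₀ * b) • z) t := by
        simp only [mul_smul]
        rcases ht with ht | ht
        · simpa [cW t ht] using hI.smul_of_fix hcV (h3 z hz t ht)
        · simpa [cZ' t ht] using hI.smul_of_fix hcV (h4 z hz t ht)
      simpa [hd t (Or.inl ht)] using hI.smul_of_fix (fun v hv => hd v (Or.inr hv)) this
    have i2 : I V z₁ y :=
      hI.trans_of_subset hVf (hWf.union hZ) (by rw [Set.union_comm]) i1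
        (hdE _ (Set.smul_mem_smul_set hz) y hy)
    have i3 : ∀ v ∈ V, I (k • X) y v := fun v hv =>
      hI.trans_of_subset hkX hX (by rw [hW, Set.union_comm])
        (fun x hx => hI.symm _ _ _ (hXE x hx y hy)) (hVE v hv y (Or.inr hy))
    exact hI.symm _ _ _ (hI.trans_of_subset hkX hVf Set.subset_union_right i3 (hI.symm _ _ _ i2))

/-- The condition on `X` under which the conjugators of `k₁, …, k₄` can be committed to fix the
sets `X₀ = X` and `Xᵢ = kᵢ Xᵢ₋₁`: `X₀` is independent from `X₂` over `X₁`, and `X₂` from `X₄` over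
`X₃`. -/
def IsGood (I : Set M → M → M → Prop) (k₁ k₂ k₃ k₄ : G) (X : Set M) : Prop :=
  (∀ x ∈ X, ∀ y ∈ X, I (k₁ • X) x (k₂ • k₁ • y)) ∧
    ∀ x ∈ X, ∀ y ∈ X, I (k₃ • k₂ • k₁ • X) (k₂ • k₁ • x) (k₄ • k₃ • k₂ • k₁ • y)

/-- The conjugators `a₁, …, a₄` fix the sets `X₀ = X` and `Xᵢ = kᵢ Xᵢ₋₁`: each `aᵢ` fixes `Xᵢ₋₁` and
`Xᵢ`. -/
def FixesChain (k₁ k₂ k₃ k₄ a₁ a₂ a₃ a₄ : G) (X : Set M) : Prop :=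
  ∀ x ∈ X, (a₁ • x = x ∧ a₁ • k₁ • x = k₁ • x) ∧
    (a₂ • k₁ • x = k₁ • x ∧ a₂ • k₂ • k₁ • x = k₂ • k₁ • x) ∧
    (a₃ • k₂ • k₁ • x = k₂ • k₁ • x ∧ a₃ • k₃ • k₂ • k₁ • x = k₃ • k₂ • k₁ • x) ∧
    (a₄ • k₃ • k₂ • k₁ • x = k₃ • k₂ • k₁ • x ∧
      a₄ • k₄ • k₃ • k₂ • k₁ • x = k₄ • k₃ • k₂ • k₁ • x)

/-- Every finite set extends to a good one, at the expense of conjugating `k₁` and `k₄`: enlarge the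
middle set `X₂` until `X₁` contains `X₀` and `X₃` contains `X₄`, and make the new points of `X₀` and
`X₄` independent. -/
theorem exists_isGood (hI : StationaryIndep G I) (k₁ k₂ k₃ k₄ : G) {X : Set M} (hX : X.Finite) :
    ∃ (a₁ a₄ : G) (Z : Set M), Z.Finite ∧ X ⊆ Z ∧ FixesChain k₁ k₂ k₃ k₄ a₁ 1 1 a₄ X ∧
      IsGood I (a₁ * k₁ * a₁⁻¹) k₂ k₃ (a₄ * k₄ * a₄⁻¹) Z := by
  set U : Set M := k₂ • (X ∪ k₁ • X) ∪ (k₂ * k₁) • X ∪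
    k₃⁻¹ • ((k₃ * k₂ * k₁) • X ∪ (k₄ * k₃ * k₂ * k₁) • X) with hU
  have hUf : U.Finite := (((hX.union hX.smul_set).smul_set).union hX.smul_set).union
    ((hX.smul_set.union hX.smul_set).smul_set)
  obtain ⟨a₁, ha₁, hi₁⟩ := hI.exist (k₁⁻¹ • k₂⁻¹ • U) (k₂⁻¹ • U) U hUf.smul_set.smul_set
    hUf.smul_set hUf
  obtain ⟨a₄, ha₄, hi₄⟩ := hI.exist (k₄ • k₃ • U) (k₃ • U) U hUf.smul_set.smul_set
    hUf.smul_set hUf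
  have m0 : ∀ x ∈ X, x ∈ k₂⁻¹ • U := fun x hx => by
    rw [Set.mem_inv_smul_set_iff]
    exact Or.inl (Or.inl (Set.smul_mem_smul_set (Or.inl hx)))
  have m1 : ∀ x ∈ X, k₁ • x ∈ k₂⁻¹ • U := fun x hx => by
    rw [Set.mem_inv_smul_set_iff]
    exact Or.inl (Or.inl (Set.smul_mem_smul_set (Or.inr (Set.smul_mem_smul_set hx))))
  have m3 : ∀ x ∈ X, k₃ • k₂ • k₁ • x ∈ k₃ • U := fun x hx => Set.smul_mem_smul_set
    (Or.inl (Or.inr (by simpa [mul_smul] using Set.smul_mem_smul_set (a := k₂ * k₁) hx)))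
  have m4 : ∀ x ∈ X, k₄ • k₃ • k₂ • k₁ • x ∈ k₃ • U := fun x hx => by
    rw [Set.mem_smul_set_iff_inv_smul_mem]
    exact Or.inr (Set.smul_mem_smul_set (Or.inr
      (by simpa [mul_smul] using Set.smul_mem_smul_set (a := k₄ * k₃ * k₂ * k₁) hx)))
  refine ⟨a₁, a₄, a₁ • k₁⁻¹ • k₂⁻¹ • U, hUf.smul_set.smul_set.smul_set, ?_, ?_, ?_⟩
  · intro x hx
    rw [← ha₁ x (m0 x hx)]
    refine Set.smul_mem_smul_set ?_
    rw [Set.mem_inv_smul_set_iff]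
    exact m1 x hx
  · intro x hx
    exact ⟨⟨ha₁ _ (m0 x hx), ha₁ _ (m1 x hx)⟩, by simp, by simp, ha₄ _ (m3 x hx), ha₄ _ (m4 x hx)⟩
  · have n2 : ∀ u ∈ U, k₂⁻¹ • u ∈ k₂⁻¹ • U := fun u hu => Set.smul_mem_smul_set hu
    have n3 : ∀ u ∈ U, k₃ • u ∈ k₃ • U := fun u hu => Set.smul_mem_smul_set hu
    have e1 : ∀ u ∈ U, (a₁ * k₁ * a₁⁻¹) • a₁ • k₁⁻¹ • k₂⁻¹ • u = k₂⁻¹ • u := fun u hu => by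
      simp only [mul_smul, inv_smul_smul, smul_inv_smul]
      exact ha₁ _ (n2 u hu)
    have e4 : ∀ u ∈ U, (a₄ * k₄ * a₄⁻¹) • k₃ • u = a₄ • k₄ • k₃ • u := fun u hu => by
      simp only [mul_smul]
      rw [inv_smul_eq_self (ha₄ _ (n3 u hu))]
    have e1' : (a₁ * k₁ * a₁⁻¹) • a₁ • k₁⁻¹ • k₂⁻¹ • U = k₂⁻¹ • U := by
      simp only [mul_smul, inv_smul_smul, smul_inv_smul]
      exact smul_set_eq_self ha₁
    constructor
    · rintro _ ⟨_, ⟨_, ⟨u, hu, rfl⟩, rfl⟩, rfl⟩ _ ⟨_, ⟨_, ⟨v, hv, rfl⟩, rfl⟩, rfl⟩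
      simp only [e1 v hv, e1', smul_inv_smul]
      exact hi₁ _ (Set.smul_mem_smul_set (n2 u hu)) v hv
    · rintro _ ⟨_, ⟨_, ⟨u, hu, rfl⟩, rfl⟩, rfl⟩ _ ⟨_, ⟨_, ⟨v, hv, rfl⟩, rfl⟩, rfl⟩
      simp only [e1 u hu, e1 v hv, e1', smul_inv_smul, e4 v hv]
      exact hI.symm _ _ _ (hi₄ _ (Set.smul_mem_smul_set (n3 v hv)) u hu)

/-- Over a good set `X`, any `u` that agrees with `k₄k₃k₂k₁` on `X` can be matched on a larger
finite set `Z` by conjugating the `kᵢ`, without changing what has been committed on `X`. The images of `Z`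
in the positions 1 and 3 are made independent from `X₂` by `exists_conj_indep`; a generic choice in
position 2 then satisfies the hypotheses of `exists_conj_eq` for `k₂` and `k₃`. -/
theorem IsGood.exists_conj_eq (hI : StationaryIndep G I) {k₁ k₂ k₃ k₄ : G}
    (h₁ : MovesMaximally I k₁) (h₂ : MovesMaximally I k₂) (h₃ : MovesMaximally I k₃)
    (h₄ : MovesMaximally I k₄) {X Z : Set M} (hX : X.Finite) (hZ : Z.Finite)
    (hgood : IsGood I k₁ k₂ k₃ k₄ X) {u : G} (hu : ∀ x ∈ X, k₄ • k₃ • k₂ • k₁ • x = u • x) :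
    ∃ a₁ a₂ a₃ a₄ : G, FixesChain k₁ k₂ k₃ k₄ a₁ a₂ a₃ a₄ X ∧
      ∀ z ∈ Z, (a₄ * k₄ * a₄⁻¹) • (a₃ * k₃ * a₃⁻¹) • (a₂ * k₂ * a₂⁻¹) • (a₁ * k₁ * a₁⁻¹) • z =
        u • z := by
  obtain ⟨g1, g2⟩ := hgood
  have huX : u • X = k₄ • k₃ • k₂ • k₁ • X := by
    rw [smul_set_eq_of_forall (g := u) (h := k₄ * k₃ * k₂ * k₁)
      (fun x hx => by simpa only [mul_smul] using (hu x hx).symm)]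
    simp only [mul_smul]
  have hiX : k₄⁻¹ • u • X = k₃ • k₂ • k₁ • X := by rw [huX, inv_smul_smul]
  have m1 : ∀ x ∈ X, k₁ • x ∈ k₁ • X := fun x hx => Set.smul_mem_smul_set hx
  have m2 : ∀ x ∈ X, k₂ • k₁ • x ∈ k₂ • k₁ • X := fun x hx => Set.smul_mem_smul_set (m1 x hx)
  have m3 : ∀ x ∈ X, k₃ • k₂ • k₁ • x ∈ k₃ • k₂ • k₁ • X :=
    fun x hx => Set.smul_mem_smul_set (m2 x hx)
  have f1 : (k₁ • X).Finite := hX.smul_set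
  have f2 : (k₂ • k₁ • X).Finite := f1.smul_set
  have f3 : (k₃ • k₂ • k₁ • X).Finite := f2.smul_set
  obtain ⟨a₁, a1X, a1k, i1⟩ := h₁.exists_conj_indep hI hX hZ f2 (E := k₂ • k₁ • X)
    (by rintro x hx _ ⟨_, ⟨y, hy, rfl⟩, rfl⟩; exact g1 x hx y hy)
  obtain ⟨a₄, a4X, a4k, i3⟩ := h₄.inv.exists_conj_indep hI (X := u • X) (Z := u • Z)
    (E := k₂ • k₁ • X) hX.smul_set hZ.smul_set f2
    (by
      rintro _ ⟨x, hx, rfl⟩ _ ⟨_, ⟨y, hy, rfl⟩, rfl⟩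
      simp only [hiX]
      rw [← hu x hx]
      exact hI.symm _ _ _ (g2 y hy x hx))
  rw [hiX] at i3
  have a4k' : ∀ x ∈ X, a₄ • k₃ • k₂ • k₁ • x = k₃ • k₂ • k₁ • x := fun x hx => by
    have := a4k _ (Set.smul_mem_smul_set hx)
    rwa [← hu x hx, inv_smul_smul] at this
  have a4X' : ∀ x ∈ X, a₄ • u • x = u • x := fun x hx => a4X _ (Set.smul_mem_smul_set hx)
  -- the positions 1, 2 and 3 are the images of `Z` under `τ₁`, `τ₂` and `τ₃`
  set τ₁ := a₁ * k₁ * a₁⁻¹ with hτ₁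
  set τ₃ := a₄ * k₄⁻¹ * a₄⁻¹ * u with hτ₃
  have i3' : ∀ z ∈ Z, ∀ y ∈ k₂ • k₁ • X, I (k₃ • k₂ • k₁ • X) (τ₃ • z) y := fun z hz y hy => by
    rw [hτ₃, mul_smul _ u]
    exact i3 _ (Set.smul_mem_smul_set hz) y hy
  obtain ⟨c, cX, hc⟩ := hI.exist ((k₂ * τ₁) • Z) (k₂ • k₁ • X)
    (k₁ • X ∪ τ₁ • Z ∪ (k₃ • k₂ • k₁ • X ∪ τ₃ • Z)) hZ.smul_set f2
    ((f1.union hZ.smul_set).union (f3.union hZ.smul_set))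
  set τ₂ := c * k₂ * τ₁ with hτ₂
  have hc' : ∀ z ∈ Z, ∀ y ∈ k₁ • X ∪ τ₁ • Z ∪ (k₃ • k₂ • k₁ • X ∪ τ₃ • Z),
      I (k₂ • k₁ • X) (τ₂ • z) y := fun z hz y hy => by
    rw [hτ₂, mul_assoc, mul_smul]
    exact hc _ (Set.smul_mem_smul_set hz) y hy
  have t1 : ∀ x ∈ X, τ₁ • x = k₁ • x := fun x hx => by
    rw [hτ₁, mul_smul, mul_smul, inv_smul_eq_self (a1X x hx), a1k x hx]
  have t2 : ∀ x ∈ X, τ₂ • x = k₂ • k₁ • x := fun x hx => by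
    rw [hτ₂, mul_smul, mul_smul, t1 x hx, cX _ (m2 x hx)]
  have t3 : ∀ x ∈ X, τ₃ • x = k₃ • k₂ • k₁ • x := fun x hx => by
    rw [hτ₃, mul_smul, mul_smul, mul_smul, inv_smul_eq_self (a4X' x hx), ← hu x hx, inv_smul_smul,
      a4k' x hx]
  obtain ⟨a₂, a2X, a2k, i2⟩ := h₂.exists_conj_eq hI (X := k₁ • X) (Z := τ₁ • Z) (σ := c * k₂) f1
    hZ.smul_set
    (by rintro _ ⟨x, hx, rfl⟩; simp only [mul_smul]; exact cX _ (m2 x hx))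
    (by
      rintro _ ⟨z, hz, rfl⟩ _ ⟨x, hx, rfl⟩
      exact i1 z hz _ (m2 x hx))
    (by
      rintro _ ⟨z, hz, rfl⟩ x hx
      simpa only [hτ₂, mul_smul] using hc' z hz x (Or.inl (Or.inl hx)))
    (by
      rintro _ ⟨z, hz, rfl⟩ z' hz'
      simpa only [hτ₂, mul_smul] using hc' z hz z' (Or.inl (Or.inr hz')))
  obtain ⟨a₃, a3X, a3k, i4⟩ := h₃.exists_conj_eq hI (X := k₂ • k₁ • X) (Z := τ₂ • Z)
    (σ := τ₃ * τ₂⁻¹) f2 hZ.smul_set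
    (by
      rintro _ ⟨_, ⟨x, hx, rfl⟩, rfl⟩
      simp only [mul_smul]
      rw [← t2 x hx, inv_smul_smul, t3 x hx, t2 x hx])
    (by
      rintro _ ⟨z, hz, rfl⟩ _ ⟨_, ⟨x, hx, rfl⟩, rfl⟩
      exact hc' z hz _ (Or.inr (Or.inl (m3 x hx))))
    (by
      rintro _ ⟨z, hz, rfl⟩ x hx
      simpa [mul_smul] using i3' z hz x hx)
    (by
      rintro _ ⟨z, hz, rfl⟩ _ ⟨z', hz', rfl⟩
      simp only [mul_smul, inv_smul_smul]
      exact hI.trans_of_subset f3 f2 Set.subset_union_right (i3' z hz)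
        (hI.symm _ _ _ (hc' z' hz' _ (Or.inr (Or.inr (Set.smul_mem_smul_set hz))))))
  refine ⟨a₁, a₂, a₃, a₄, fun x hx => ⟨⟨a1X x hx, a1k x hx⟩, ⟨a2X _ (m1 x hx), a2k _ (m1 x hx)⟩,
    ⟨a3X _ (m2 x hx), a3k _ (m2 x hx)⟩, a4k' x hx, by rw [hu x hx, a4X' x hx]⟩, fun z hz => ?_⟩
  have e2 : (a₂ * k₂ * a₂⁻¹) • τ₁ • z = τ₂ • z := by
    rw [i2 _ (Set.smul_mem_smul_set hz), hτ₂, mul_smul (c * k₂)]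
  have e3 : (a₃ * k₃ * a₃⁻¹) • τ₂ • z = τ₃ • z := by
    rw [i4 _ (Set.smul_mem_smul_set hz), mul_smul, inv_smul_smul]
  rw [e2, e3, hτ₃]
  simp only [mul_smul, inv_smul_smul, smul_inv_smul]

end Independence

/-! ### Limits of finite approximations -/

section Limits

/-- The action of `G` on `M` is closed: a sequence in `G` that is eventually constant at every
point, and whose inverses are so too, has a limit in `G`. This says that the permutation group
induced by `G` is closed in the symmetric group of `M`. The set `F n` consists of points whose
images do not change after step `n`. -/
def IsClosedAction (G M : Type*) [Group G] [MulAction G M] : Prop :=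
  ∀ (s : ℕ → G) (F : ℕ → Set M), Monotone F → (∀ n m, n ≤ m → ∀ x ∈ F n, s m • x = s n • x) →
    (∀ x, ∃ n, x ∈ F n) → (∀ y, ∃ n, ∃ x ∈ F n, s n • x = y) →
    ∃ k : G, ∀ n, ∀ x ∈ F n, k • x = s n • x

variable {G M : Type*} [Group G] [MulAction G M]

/-- The Rasiowa–Sikorski lemma for families of group elements: let the conditions in `P` determine
finite parts of elements of `G` indexed by `J`, the part with index `j` being the restriction of
`aut p j` to `dom p j`. If every point can be put into the domain and into the range of each part,
then some family of elements of `G` extends conditions in every one of countably many cofinal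
sets. -/
theorem exists_limit [Countable M] (hG : IsClosedAction G M) {P J ι : Type*} [Preorder P]
    [Countable J] [Countable ι] (aut : P → J → G) (dom : P → J → Set M)
    (mono : ∀ p q, p ≤ q → ∀ j, dom p j ⊆ dom q j)
    (agree : ∀ p q, p ≤ q → ∀ j, ∀ x ∈ dom p j, aut q j • x = aut p j • x)
    (hdom : ∀ p j x, ∃ q, p ≤ q ∧ x ∈ dom q j)
    (hran : ∀ p j y, ∃ q, p ≤ q ∧ ∃ x ∈ dom q j, aut q j • x = y)
    (D : ι → Set P) (hD : ∀ i p, ∃ q, p ≤ q ∧ q ∈ D i) (p₀ : P) :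
    ∃ k : J → G, ∀ i, ∃ p ∈ D i, ∀ j, ∀ x ∈ dom p j, k j • x = aut p j • x := by
  let C : (J × M) ⊕ (J × M) ⊕ ι → Order.Cofinal P
    | .inl (j, x) => ⟨{q | x ∈ dom q j}, fun p => by
        obtain ⟨q, h1, h2⟩ := hdom p j x
        exact ⟨q, h2, h1⟩⟩
    | .inr (.inl (j, y)) => ⟨{q | ∃ x ∈ dom q j, aut q j • x = y}, fun p => by
        obtain ⟨q, h1, h2⟩ := hran p j y
        exact ⟨q, h2, h1⟩⟩
    | .inr (.inr i) => ⟨D i, fun p => by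
        obtain ⟨q, h1, h2⟩ := hD i p
        exact ⟨q, h2, h1⟩⟩
  have := Encodable.ofCountable ((J × M) ⊕ (J × M) ⊕ ι)
  set s := Order.sequenceOfCofinals p₀ C with hs
  have hmono : Monotone s := Order.sequenceOfCofinals.monotone p₀ C
  have hmem : ∀ c, ∃ n, s n ∈ C c := fun c => ⟨_, Order.sequenceOfCofinals.encode_mem p₀ C c⟩
  have hk : ∀ j, ∃ k : G, ∀ n, ∀ x ∈ dom (s n) j, k • x = aut (s n) j • x := fun j =>
    hG (fun n => aut (s n) j) (fun n => dom (s n) j) (fun n m h => mono _ _ (hmono h) j)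
      (fun n m h => agree _ _ (hmono h) j) (fun x => hmem (.inl (j, x)))
      (fun y => hmem (.inr (.inl (j, y))))
  choose k hk using hk
  refine ⟨k, fun i => ?_⟩
  obtain ⟨n, hn⟩ := hmem (.inr (.inr i))
  exact ⟨s n, hn, fun j => hk j n⟩

/-- The Baire category theorem for `G`: if each set `D i` is dense and open, in the sense that every
finite part of an element of `G` extends to one that forces membership in `D i`, then the sets `D i`
have a common element. -/
theorem exists_forall_mem_of_dense [Countable M] (hG : IsClosedAction G M) {ι : Type*}
    [Countable ι] (D : ι → Set G)
    (hD : ∀ i (e : G) (F : Set M), F.Finite → ∃ (e' : G) (F' : Set M), F'.Finite ∧ F ⊆ F' ∧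
      (∀ x ∈ F, e' • x = e • x) ∧ ∀ k : G, (∀ x ∈ F', k • x = e' • x) → k ∈ D i) :
    ∃ k : G, ∀ i, k ∈ D i := by
  let P := G × {F : Set M // F.Finite}
  let _ : Preorder P :=
    { le := fun p q => p.2.1 ⊆ q.2.1 ∧ ∀ x ∈ p.2.1, q.1 • x = p.1 • x
      le_refl := fun p => ⟨subset_rfl, fun _ _ => rfl⟩
      le_trans := fun p q r h h' => ⟨h.1.trans h'.1, fun x hx => by
        rw [h'.2 x (h.1 hx), h.2 x hx]⟩ }
  have enlarge : ∀ (p : P) (x : M), ∃ q : P, p ≤ q ∧ x ∈ q.2.1 ∧ q.1 = p.1 := fun p x =>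
    ⟨(p.1, ⟨insert x p.2.1, p.2.2.insert x⟩), ⟨Set.subset_insert _ _, fun _ _ => rfl⟩,
      Set.mem_insert _ _, rfl⟩
  obtain ⟨k, hk⟩ := exists_limit (P := P) (J := Unit) hG (fun p _ => p.1) (fun p _ => p.2.1)
    (fun p q (h : _ ∧ _) _ => h.1) (fun p q (h : _ ∧ _) _ => h.2)
    (fun p _ x => (enlarge p x).imp fun q h => ⟨h.1, h.2.1⟩)
    (fun p _ y => (enlarge p (p.1⁻¹ • y)).imp fun q h =>
      ⟨h.1, _, h.2.1, by rw [h.2.2, smul_inv_smul]⟩)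
    (fun i => {p : P | ∀ k : G, (∀ x ∈ p.2.1, k • x = p.1 • x) → k ∈ D i})
    (fun i p => by
      obtain ⟨e', F', hF', h1, h2, h3⟩ := hD i p.1 p.2.1 p.2.2
      exact ⟨(e', ⟨F', hF'⟩), ⟨h1, h2⟩, h3⟩)
    (1, ⟨∅, Set.finite_empty⟩)
  refine ⟨k (), fun i => ?_⟩
  obtain ⟨p, hp, hpk⟩ := hk i
  exact hp _ (hpk ())

end Limits

/-! ### Eight conjugates of an element that moves maximally -/

section EightConjugates

variable {G M : Type*} [Group G] [MulAction G M]

/-- The partial products, from the right, of the conjugates of `g` by `e 0, e 1, e 2, e 3`. -/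
def conjChain (g : G) (e : Fin 4 → G) : Fin 5 → G :=
  Fin.induction 1 fun j c => e j * g * (e j)⁻¹ * c

theorem conjChain_succ (g : G) (e : Fin 4 → G) (j : Fin 4) :
    conjChain g e j.succ = e j * g * (e j)⁻¹ * conjChain g e j.castSucc :=
  Fin.induction_succ _ _ _

/-- The conjugators `e'` agree with `e` as far as the conjugates are determined on the chain of
images of `X`: the inverses of `e j` and `e' j` agree on the `j`-th and on the next image. -/
def Extends (g : G) (e e' : Fin 4 → G) (X : Set M) : Prop :=
  ∀ x ∈ X, ∀ j : Fin 4,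
    (e' j)⁻¹ • conjChain g e j.castSucc • x = (e j)⁻¹ • conjChain g e j.castSucc • x ∧
      (e' j)⁻¹ • conjChain g e j.succ • x = (e j)⁻¹ • conjChain g e j.succ • x

variable {g : G} {e e' e'' : Fin 4 → G} {X Y : Set M}

theorem Extends.conjChain_eq (h : Extends g e e' X) {x : M} (hx : x ∈ X) (i : Fin 5) :
    conjChain g e' i • x = conjChain g e i • x := by
  induction i using Fin.induction with
  | zero => rfl
  | succ j ih =>
    obtain ⟨h1, h2⟩ := h x hx j
    rw [conjChain_succ, mul_smul, ih, mul_smul, mul_smul, h1, ← inv_smul_eq_iff.2 h2.symm, inv_inv]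
    rw [conjChain_succ]
    simp only [mul_smul, inv_smul_smul]

theorem Extends.refl (g : G) (e : Fin 4 → G) (X : Set M) : Extends g e e X :=
  fun _ _ _ => ⟨rfl, rfl⟩

theorem Extends.trans (h : Extends g e e' X) (h' : Extends g e' e'' Y) (hXY : X ⊆ Y) :
    Extends g e e'' X := by
  intro x hx j
  obtain ⟨h1, h2⟩ := h x hx j
  obtain ⟨h3, h4⟩ := h' x (hXY hx) j
  rw [h.conjChain_eq hx] at h3 h4
  exact ⟨h3.trans h1, h4.trans h2⟩

theorem Extends.mono (h : Extends g e e' Y) (hXY : X ⊆ Y) : Extends g e e' X :=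
  fun x hx => h x (hXY hx)

theorem conjChain_smul (g : G) (e : Fin 4 → G) (x : M) :
    conjChain g e 1 • x = (e 0 * g * (e 0)⁻¹) • x ∧
    conjChain g e 2 • x = (e 1 * g * (e 1)⁻¹) • (e 0 * g * (e 0)⁻¹) • x ∧
    conjChain g e 3 • x = (e 2 * g * (e 2)⁻¹) • (e 1 * g * (e 1)⁻¹) • (e 0 * g * (e 0)⁻¹) • x ∧
    conjChain g e 4 • x = (e 3 * g * (e 3)⁻¹) • (e 2 * g * (e 2)⁻¹) • (e 1 * g * (e 1)⁻¹) •
      (e 0 * g * (e 0)⁻¹) • x := by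
  have c1 : conjChain g e 1 = (e 0 * g * (e 0)⁻¹) * 1 := rfl
  have c2 : conjChain g e 2 = (e 1 * g * (e 1)⁻¹) * conjChain g e 1 := rfl
  have c3 : conjChain g e 3 = (e 2 * g * (e 2)⁻¹) * conjChain g e 2 := rfl
  have c4 : conjChain g e 4 = (e 3 * g * (e 3)⁻¹) * conjChain g e 3 := rfl
  rw [c4, c3, c2, c1, mul_one]
  simp only [mul_smul, and_self]

/-- Conjugators that are multiplied by elements fixing the chain still agree with the old ones as far
as this is required. -/
theorem FixesChain.extends_mul {a : Fin 4 → G}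
    (h : FixesChain (e 0 * g * (e 0)⁻¹) (e 1 * g * (e 1)⁻¹) (e 2 * g * (e 2)⁻¹)
      (e 3 * g * (e 3)⁻¹) (a 0) (a 1) (a 2) (a 3) X) :
    Extends g e (a * e) X := by
  intro x hx j
  obtain ⟨⟨h1, h2⟩, ⟨h3, h4⟩, ⟨h5, h6⟩, h7, h8⟩ := h x hx
  obtain ⟨c1, c2, c3, c4⟩ := conjChain_smul g e x
  have c0 : conjChain g e 0 • x = x := one_smul G x
  have key : ∀ (j : Fin 4) (y : M), a j • y = y → ((a * e) j)⁻¹ • y = (e j)⁻¹ • y := by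
    intro j y hy
    rw [Pi.mul_apply, mul_inv_rev, mul_smul, inv_smul_eq_self hy]
  rw [← c4] at h8
  rw [← c3] at h6 h7
  rw [← c2] at h4 h5
  rw [← c1] at h2 h3
  rw [← c0] at h1
  match j with
  | 0 => exact ⟨key 0 _ h1, key 0 _ h2⟩
  | 1 => exact ⟨key 1 _ h3, key 1 _ h4⟩
  | 2 => exact ⟨key 2 _ h5, key 2 _ h6⟩
  | 3 => exact ⟨key 3 _ h7, key 3 _ h8⟩

/-- Goodness of the chain of conjugates given by `e`. -/
def IsGoodChain (I : Set M → M → M → Prop) (g : G) (e : Fin 4 → G) (X : Set M) : Prop :=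
  IsGood I (e 0 * g * (e 0)⁻¹) (e 1 * g * (e 1)⁻¹) (e 2 * g * (e 2)⁻¹) (e 3 * g * (e 3)⁻¹) X

variable {I : Set M → M → M → Prop}

/-- One turn of the game. Two chains of conjugates with products `w` and `w'` satisfy `w = f w'` on
`X`, and the first one is good. The second chain may be extended at will, to a good one; the first
chain then follows, as it is good. -/
theorem exists_turn (hI : StationaryIndep G I) (hg : MovesMaximally I g) (f : G)
    {l r : Fin 4 → G} {X T : Set M} (hX : X.Finite) (hT : T.Finite) (hl : IsGoodChain I g l X)
    (h : ∀ x ∈ X, conjChain g l 4 • x = f • conjChain g r 4 • x) :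
    ∃ (l' r' : Fin 4 → G) (Z : Set M), Z.Finite ∧ X ∪ T ⊆ Z ∧ Extends g l l' X ∧
      Extends g r r' (X ∪ T) ∧ IsGoodChain I g r' Z ∧
      ∀ x ∈ Z, conjChain g l' 4 • x = f • conjChain g r' 4 • x := by
  obtain ⟨a₁, a₄, Z, hZ, hXZ, hfix, hgood⟩ := exists_isGood hI (r 0 * g * (r 0)⁻¹)
    (r 1 * g * (r 1)⁻¹) (r 2 * g * (r 2)⁻¹) (r 3 * g * (r 3)⁻¹) (hX.union hT)
  have hr : Extends g r (![a₁, 1, 1, a₄] * r) (X ∪ T) := FixesChain.extends_mul hfix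
  set r' := ![a₁, 1, 1, a₄] * r with hr'
  have hgood' : IsGoodChain I g r' Z := by
    simpa [IsGoodChain, hr', mul_assoc] using hgood
  obtain ⟨b₁, b₂, b₃, b₄, hb, hbZ⟩ := hl.exists_conj_eq hI (hg.conj hI _) (hg.conj hI _)
    (hg.conj hI _) (hg.conj hI _) hX hZ (u := f * conjChain g r' 4) (fun x hx => by
      rw [← (conjChain_smul g l x).2.2.2, mul_smul f, hr.conjChain_eq (Or.inl hx), ← h x hx])
  have hl' : Extends g l (![b₁, b₂, b₃, b₄] * l) X := FixesChain.extends_mul hb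
  refine ⟨_, r', Z, hZ, hXZ, hl', hr, hgood', fun x hx => ?_⟩
  rw [← mul_smul, ← hbZ x hx, (conjChain_smul g _ x).2.2.2]
  simp [mul_assoc]

/-- A position of the game: the conjugators of two chains of four conjugates of `g`, and a finite
set `X` on which the products `w` and `w'` of the two chains satisfy `w = f w'`. The chain on
side `side` is good. -/
structure Position (I : Set M → M → M → Prop) (g f : G) where
  /-- The conjugators of the two chains. -/
  conj : Bool → Fin 4 → G
  /-- The finite set on which the chains are committed. -/
  carrier : Set M
  /-- The side on which the chain is good. -/
  side : Bool
  finite : carrier.Finite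
  good : IsGoodChain I g (conj side) carrier
  agree : ∀ x ∈ carrier, conjChain g (conj true) 4 • x = f • conjChain g (conj false) 4 • x

namespace Position

variable {f : G}

instance : Preorder (Position I g f) where
  le p q := p.carrier ⊆ q.carrier ∧ ∀ b, Extends g (p.conj b) (q.conj b) p.carrier
  le_refl p := ⟨subset_rfl, fun _ => Extends.refl _ _ _⟩
  le_trans _ _ _ h h' := ⟨h.1.trans h'.1, fun b => (h.2 b).trans (h'.2 b) h.1⟩

/-- One turn: the other side becomes good, and any finite set `T` can be added; on `T` the
conjugators of that side do not change. -/
theorem exists_ge (hI : StationaryIndep G I) (hg : MovesMaximally I g) (p : Position I g f)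
    {T : Set M} (hT : T.Finite) :
    ∃ q, p ≤ q ∧ q.side = !p.side ∧ T ⊆ q.carrier ∧
      Extends g (p.conj !p.side) (q.conj !p.side) T := by
  obtain ⟨c, X, b, hX, hgood, h⟩ := p
  cases b with
  | true =>
    obtain ⟨l', r', Z, hZ, hXZ, hl, hr, hgood', h'⟩ := exists_turn hI hg f hX hT hgood h
    refine ⟨⟨fun b => cond b l' r', Z, false, hZ, hgood', h'⟩,
      ⟨Set.subset_union_left.trans hXZ, ?_⟩, rfl, Set.subset_union_right.trans hXZ,
      hr.mono Set.subset_union_right⟩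
    rintro (_ | _)
    exacts [hr.mono Set.subset_union_left, hl]
  | false =>
    obtain ⟨l', r', Z, hZ, hXZ, hl, hr, hgood', h'⟩ := exists_turn hI hg f⁻¹ hX hT hgood
      (fun x hx => by rw [h x hx, inv_smul_smul])
    refine ⟨⟨fun b => cond b r' l', Z, true, hZ, hgood', fun x hx => by
        simp only [cond_true, cond_false, h' x hx, smul_inv_smul]⟩,
      ⟨Set.subset_union_left.trans hXZ, ?_⟩, rfl, Set.subset_union_right.trans hXZ,
      hr.mono Set.subset_union_right⟩
    rintro (_ | _)
    exacts [hl, hr.mono Set.subset_union_left]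

theorem exists_ge_side (hI : StationaryIndep G I) (hg : MovesMaximally I g) (p : Position I g f)
    (b : Bool) : ∃ q, p ≤ q ∧ q.side = b := by
  by_cases hb : p.side = b
  · exact ⟨p, le_refl p, hb⟩
  · obtain ⟨q, h1, h2, -⟩ := p.exists_ge hI hg Set.finite_empty
    exact ⟨q, h1, by rw [h2]; cases b <;> simpa using hb⟩

/-- Any point can be put into any set of a chain; the conjugator at this point does not change in
the last turn, which gives the freedom to choose the point depending on it. -/
theorem exists_ge_conj (hI : StationaryIndep G I) (hg : MovesMaximally I g) (p : Position I g f)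
    (b : Bool) (i : Fin 5) (y : (Fin 4 → G) → M) :
    ∃ q q' : Position I g f, p ≤ q ∧ q ≤ q' ∧ ∃ t ∈ q'.carrier,
      conjChain g (q'.conj b) i • t = y (q.conj b) ∧ Extends g (q.conj b) (q'.conj b) {t} := by
  obtain ⟨q, h1, h2⟩ := p.exists_ge_side hI hg !b
  obtain ⟨q', h3, -, h4, h5⟩ := q.exists_ge hI hg
    (Set.finite_singleton ((conjChain g (q.conj b) i)⁻¹ • y (q.conj b)))
  rw [h2, Bool.not_not] at h5
  refine ⟨q, q', h1, h3, _, h4 rfl, ?_, h5⟩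
  rw [h5.conjChain_eq rfl, smul_inv_smul]

end Position

/-- If `g` moves maximally, any `f` is `w w'⁻¹` for products `w` and `w'` of four conjugates of `g`.
The conjugators are built by playing the game of `exists_turn` with the two sides in turn. -/
theorem MovesMaximally.exists_conjChain [Countable M] [FaithfulSMul G M] (hG : IsClosedAction G M)
    (hI : StationaryIndep G I) (hg : MovesMaximally I g) (f : G) :
    ∃ e e' : Fin 4 → G, f = conjChain g e 4 * (conjChain g e' 4)⁻¹ := by
  obtain ⟨k, hk⟩ := exists_limit (P := Position I g f) (J := Bool × Fin 4) hG
    (fun p j => (p.conj j.1 j.2)⁻¹)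
    (fun p j => {y | ∃ x ∈ p.carrier, y = conjChain g (p.conj j.1) j.2.castSucc • x ∨
      y = conjChain g (p.conj j.1) j.2.succ • x})
    (by
      rintro p q ⟨h1, h2⟩ j y ⟨x, hx, hy⟩
      refine ⟨x, h1 hx, ?_⟩
      rwa [(h2 j.1).conjChain_eq hx, (h2 j.1).conjChain_eq hx])
    (by
      rintro p q ⟨h1, h2⟩ j y ⟨x, hx, rfl | rfl⟩
      exacts [(h2 j.1 x hx j.2).1, (h2 j.1 x hx j.2).2])
    (by
      rintro p ⟨b, j⟩ x
      obtain ⟨q, q', h1, h2, t, ht, h3, -⟩ := p.exists_ge_conj hI hg b j.castSucc fun _ => x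
      exact ⟨q', h1.trans h2, t, ht, Or.inl h3.symm⟩)
    (by
      rintro p ⟨b, j⟩ y
      obtain ⟨q, q', h1, h2, t, ht, h3, h4⟩ :=
        p.exists_ge_conj hI hg b j.castSucc fun e => e j • y
      refine ⟨q', h1.trans h2, _, ⟨t, ht, Or.inl rfl⟩, ?_⟩
      have h5 := (h4 t rfl j).1
      rw [← h4.conjChain_eq rfl] at h5
      rw [h5, h3, inv_smul_smul])
    (fun x : M => {p | x ∈ p.carrier})
    (fun x p => by
      obtain ⟨q, h1, -, h2, -⟩ := p.exists_ge hI hg (Set.finite_singleton x)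
      exact ⟨q, h1, h2 rfl⟩)
    ⟨fun _ => 1, ∅, true, Set.finite_empty, by simp [IsGoodChain, IsGood], by simp⟩
  refine ⟨fun j => (k (true, j))⁻¹, fun j => (k (false, j))⁻¹, eq_mul_inv_of_mul_eq ?_⟩
  refine FaithfulSMul.eq_of_smul_eq_smul (α := M) fun x => ?_
  obtain ⟨p, hp, hpk⟩ := hk x
  have hext : ∀ b, Extends g (p.conj b) (fun j => (k (b, j))⁻¹) {x} := by
    rintro b _ rfl j
    simp only [inv_inv]
    exact ⟨hpk (b, j) _ ⟨_, hp, Or.inl rfl⟩, hpk (b, j) _ ⟨_, hp, Or.inr rfl⟩⟩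
  rw [mul_smul, (hext true).conjChain_eq rfl, (hext false).conjChain_eq rfl, p.agree x hp]

end EightConjugates

/-! ### Commutators with a generic element -/

section Commutators

variable {G M : Type*} [Group G] [MulAction G M] {I : Set M → M → M → Prop}

/-- Every type of a point outside a finite set `X` over `X` has a realisation `a` such that `a` and
`φ a` are in the relation `N`. -/
def MovesPoints (N : M → M → Prop) (φ : G) : Prop :=
  ∀ X : Set M, X.Finite → ∀ a₀ ∉ X, ∃ σ : G, (∀ x ∈ X, σ • x = x) ∧ N (σ • a₀) (φ • σ • a₀)

/-- Extension of a finite part of `k` that controls the commutator `φ⁻¹k⁻¹φk` at a realisation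
`a = σ a₀` of a given type over `X`: the point `w = k⁻¹φk a` is in the relation `N` to `a`, and it
is as independent as this allows. -/
theorem MovesPoints.exists_extension (hI : StationaryIndep G I) {φ : G} {N : M → M → Prop}
    (hφ : MovesPoints N φ) (hNsmul : ∀ (g : G) (a b : M), N a b → N (g • a) (g • b)) (e : G)
    {F X : Set M} (hF : F.Finite) (hX : X.Finite) {a₀ : M} (ha₀ : a₀ ∉ X) :
    ∃ (e' : G) (F' A : Set M) (σ : G), F'.Finite ∧ A.Finite ∧ F ⊆ F' ∧ (∀ x ∈ F, e' • x = e • x) ∧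
      (∀ x ∈ X, σ • x = x) ∧ N (σ • a₀) (φ • σ • a₀) ∧ φ • σ • a₀ ∉ A ∧
      (∀ x ∈ X, φ • x ≠ σ • a₀) ∧ (∀ c ∈ φ⁻¹ • A, I X (σ • a₀) c) ∧
      ∀ k : G, (∀ x ∈ F', k • x = e' • x) →
        (∀ x ∈ X, (k⁻¹ * φ * k) • x ∈ A) ∧ N (σ • a₀) ((k⁻¹ * φ * k) • σ • a₀) ∧
        (k⁻¹ * φ * k) • σ • a₀ ∉ A ∧
        (∀ c ∈ A, I ((k⁻¹ * φ * k) • X) ((k⁻¹ * φ * k) • σ • a₀) c) ∧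
        (∀ c ∈ φ • insert (σ • a₀) X, I (insert (σ • a₀) A) ((k⁻¹ * φ * k) • σ • a₀) c) := by
  set A : Set M := F ∪ X ∪ (e⁻¹ * φ * e) • X with hA
  have hAf : A.Finite := (hF.union hX).union hX.smul_set
  have hXA : ∀ x ∈ X, x ∈ A := fun x hx => Or.inl (Or.inr hx)
  have hTA : ∀ x ∈ X, (e⁻¹ * φ * e) • x ∈ A := fun x hx => Or.inr (Set.smul_mem_smul_set hx)
  have hB : (e • A).Finite := hAf.smul_set
  -- the realisation `a`
  set E : Set M := A ∪ φ⁻¹ • A ∪ φ • X with hE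
  have hEf : E.Finite := (hAf.union hAf.smul_set).union hX.smul_set
  obtain ⟨σ₀, hσ₀, hi₀⟩ := hI.exist {a₀} X E (Set.finite_singleton _) hX hEf
  simp only [Set.mem_singleton_iff, forall_eq] at hi₀
  have hout : ∀ {g : G} {Y : Set M} {y : M}, (∀ x ∈ Y, g • x = x) → y ∉ Y → g • y ∉ Y := by
    intro g Y y hg hy h
    exact hy (by rwa [← smul_left_cancel g (hg _ h)])
  have hE₀ : σ₀ • a₀ ∉ E := fun h => hout hσ₀ ha₀ (hI.mem_of_self _ _ (hi₀ _ h))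
  obtain ⟨σ₁, hσ₁, hN₁⟩ := hφ E hEf _ hE₀
  have hX1 : ∀ x ∈ X, σ₁ • x = x := fun x hx => hσ₁ x (Or.inl (Or.inl (hXA x hx)))
  set a := σ₁ • σ₀ • a₀ with ha
  have haE : a ∉ E := hout hσ₁ hE₀
  have hiE : ∀ c ∈ E, I X a c := fun c hc => by
    simpa [hσ₁ c hc] using hI.smul_of_fix hX1 (hi₀ c hc)
  -- its image `y`
  have hyB : e • a ∉ e • A := fun h => haE (Or.inl (Or.inl ((Set.smul_mem_smul_set_iff).1 h)))
  obtain ⟨σ₂, hσ₂, hi₂⟩ := hI.exist {e • a} (e • A) (φ⁻¹ • e • A) (Set.finite_singleton _) hB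
    hB.smul_set
  simp only [Set.mem_singleton_iff, forall_eq] at hi₂
  have hE₂ : σ₂ • e • a ∉ e • A ∪ φ⁻¹ • e • A := fun h =>
    hout hσ₂ hyB (h.elim id fun h => hI.mem_of_self _ _ (hi₂ _ h))
  obtain ⟨σ₃, hσ₃, hN₃⟩ := hφ (e • A ∪ φ⁻¹ • e • A) (hB.union hB.smul_set) _ hE₂
  set y := σ₃ • σ₂ • e • a with hy
  have hyE : y ∉ e • A ∪ φ⁻¹ • e • A := hout hσ₃ hE₂
  have heX : (e • X).Finite := hX.smul_set
  have heXA : ∀ x ∈ e • X, x ∈ e • A := fun x hx => Set.smul_set_mono hXA hx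
  have hiy : ∀ c ∈ φ⁻¹ • e • A, I (e • X) y c := by
    have h1 : ∀ c ∈ e • A, I (e • X) (σ₂ • e • a) c := by
      rintro _ ⟨c, hc, rfl⟩
      have := hI.smul_of_fix (fun x hx => hσ₂ x (heXA x hx))
        (hI.smul e _ _ _ (hiE c (Or.inl (Or.inl hc))))
      rwa [hσ₂ _ (Set.smul_mem_smul_set hc)] at this
    intro c hc
    have h2 := hI.smul_of_fix (fun x hx => hσ₃ x (Or.inl (heXA x hx)))
      (hI.trans_of_subset heX hB Set.subset_union_right h1 (hi₂ c hc))
    rwa [hσ₃ c (Or.inr hc)] at h2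
  set e₁ := σ₃ * σ₂ * e with he₁
  have he₁A : ∀ x ∈ A, e₁ • x = e • x := fun x hx => by
    have := Set.smul_mem_smul_set (a := e) hx
    rw [he₁, mul_smul, mul_smul, hσ₂ _ this, hσ₃ _ (Or.inl this)]
  have he₁a : e₁ • a = y := by rw [he₁, mul_smul, mul_smul]
  -- the point `w`
  set w₀ := e₁⁻¹ • φ • y with hw₀
  have hAa : (insert a A).Finite := hAf.insert a
  obtain ⟨σ₄, hσ₄, hi₄⟩ := hI.exist {w₀} (insert a A) (φ • insert a X) (Set.finite_singleton _) hAa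
    (hX.insert a).smul_set
  simp only [Set.mem_singleton_iff, forall_eq] at hi₄
  have hσ₄A : ∀ x ∈ A, σ₄ • x = x := fun x hx => hσ₄ x (Or.inr hx)
  have hσ₄a : σ₄ • a = a := hσ₄ a (Or.inl rfl)
  have hw₀A : w₀ ∉ A := fun h => hyE (Or.inr (by
    rw [Set.mem_inv_smul_set_iff]
    refine ⟨w₀, h, ?_⟩
    simp only [← he₁A _ h]
    rw [hw₀, smul_inv_smul]))
  set w := σ₄ • w₀ with hw
  set e' := e₁ * σ₄⁻¹ with he'
  have he'A : ∀ x ∈ A, e' • x = e • x := fun x hx => by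
    rw [he', mul_smul, inv_smul_eq_self (hσ₄A x hx), he₁A x hx]
  have he'a : e' • a = y := by rw [he', mul_smul, inv_smul_eq_self hσ₄a, he₁a]
  have he'w : e' • w = φ • y := by rw [he', hw, mul_smul, inv_smul_smul, hw₀, smul_inv_smul]
  refine ⟨e', insert w (insert a A), A, σ₁ * σ₀, hAa.insert w, hAf, ?_, ?_, ?_, ?_, ?_, ?_, ?_, ?_⟩
  · exact fun x hx => Or.inr (Or.inr (Or.inl (Or.inl hx)))
  · exact fun x hx => he'A x (Or.inl (Or.inl hx))
  · intro x hx
    rw [mul_smul, hσ₀ x hx, hX1 x hx]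
  all_goals rw [mul_smul, ← ha]
  · exact hN₁
  · exact fun h => haE (Or.inl (Or.inr (Set.mem_inv_smul_set_iff.2 h)))
  · exact fun x hx h => haE (Or.inr ⟨x, hx, h⟩)
  · exact fun c hc => hiE c (Or.inl (Or.inr hc))
  · intro k hk
    have hkA : ∀ x ∈ A, k • x = e • x := fun x hx => by rw [hk x (Or.inr (Or.inr hx)), he'A x hx]
    have hka : k • a = y := by rw [hk a (Or.inr (Or.inl rfl)), he'a]
    have hkw : k • w = φ • y := by rw [hk w (Or.inl rfl), he'w]
    have hψa : (k⁻¹ * φ * k) • a = w := by rw [mul_smul, mul_smul, hka, ← hkw, inv_smul_smul]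
    have hψX : ∀ x ∈ X, (k⁻¹ * φ * k) • x = (e⁻¹ * φ * e) • x := fun x hx => by
      rw [mul_smul, mul_smul, hkA x (hXA x hx), inv_smul_eq_iff, hkA _ (hTA x hx), mul_smul,
        mul_smul, smul_inv_smul]
    rw [hψa, smul_set_eq_of_forall hψX]
    refine ⟨fun x hx => hψX x hx ▸ hTA x hx, ?_, hout hσ₄A hw₀A, ?_, hi₄⟩
    · have := hNsmul k⁻¹ _ _ hN₃
      rwa [← hkw, ← hka, inv_smul_smul, inv_smul_smul] at this
    · intro c hc
      have h1 : I (φ • e • X) (φ • y) (e • c) := by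
        have := hI.smul φ _ _ _ (hiy (φ⁻¹ • e • c)
          (Set.smul_mem_smul_set (Set.smul_mem_smul_set hc)))
        rwa [smul_inv_smul] at this
      have h2 := hI.smul e'⁻¹ _ _ _ h1
      rw [← he'w, inv_smul_smul, ← he'A c hc, inv_smul_smul] at h2
      have h3 : e'⁻¹ • φ • e • X = (e⁻¹ * φ * e) • X := by
        rw [inv_smul_eq_iff, smul_set_eq_of_forall (g := e') (h := e)
          (by rintro _ ⟨x, hx, rfl⟩; exact he'A _ (hTA x hx))]
        simp only [mul_smul, smul_inv_smul]
      rwa [h3] at h2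

variable {Lp : M → M → Prop}

/-- If `φ` moves a realisation of every nonalgebraic type, then a commutator of `φ` moves a
realisation of every such type along `Lp`, when `Lp` holds between independent points. -/
theorem MovesPoints.exists_commutator [Countable M] (hG : IsClosedAction G M)
    (hI : StationaryIndep G I) (hLsmul : ∀ (g : G) (a b : M), Lp a b → Lp (g • a) (g • b))
    (hLsymm : ∀ a b, Lp a b → Lp b a) (hLI : ∀ B a c, a ∉ B → c ∉ B → I B a c → Lp a c)
    {φ : G} (hφ : MovesPoints (fun a b : M => a ≠ b) φ) :
    ∃ k : G, MovesPoints Lp (φ⁻¹ * (k⁻¹ * φ * k)) := by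
  obtain ⟨k, hk⟩ := exists_forall_mem_of_dense hG (fun i : Finset M × M => {k : G |
    i.2 ∉ i.1 → ∃ σ : G, (∀ x ∈ i.1, σ • x = x) ∧
      Lp (σ • i.2) ((φ⁻¹ * (k⁻¹ * φ * k)) • σ • i.2)}) (by
    rintro ⟨X, a₀⟩ e F hF
    by_cases ha₀ : a₀ ∈ X
    · exact ⟨e, F, hF, subset_rfl, fun _ _ => rfl, fun k _ h => (h ha₀).elim⟩
    obtain ⟨e', F', A, σ, hF', -, h1, h2, h3, h4, h5, h6, -, h7⟩ := hφ.exists_extension hI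
      (fun g a b h => by simpa using h) e hF X.finite_toSet (a₀ := a₀) ha₀
    refine ⟨e', F', hF', h1, h2, fun k hk _ => ⟨σ, h3, ?_⟩⟩
    obtain ⟨-, h8, h9, -, h10⟩ := h7 k hk
    have := hLI _ _ _ (by simpa using ⟨Ne.symm h8, h9⟩) (by simpa using ⟨Ne.symm h4, h5⟩)
      (h10 _ (Set.smul_mem_smul_set (Or.inl rfl)))
    rw [mul_smul]
    simpa using hLsymm _ _ (hLsmul φ⁻¹ _ _ this))
  refine ⟨k, fun X hX a₀ ha₀ => ?_⟩
  simpa using hk (hX.toFinset, a₀) (by simpa using ha₀)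

/-- If `φ` moves a realisation of every nonalgebraic type along `Lp`, then a commutator of `φ` moves
maximally, when points in the relation `Lp` can be deleted from the base of an independence. -/
theorem MovesPoints.exists_commutator_movesMaximally [Countable M] (hG : IsClosedAction G M)
    (hI : StationaryIndep G I) (hLsmul : ∀ (g : G) (a b : M), Lp a b → Lp (g • a) (g • b))
    (hLsymm : ∀ a b, Lp a b → Lp b a) (hLne : ∀ a b, Lp a b → a ≠ b)
    (hdel : ∀ (a b c : M) (B : Set M), B.Finite → c ≠ b → Lp a b → I (insert b B) a c → I B a c)
    {φ : G} (hφ : MovesPoints Lp φ) : ∃ k : G, MovesMaximally I (φ⁻¹ * (k⁻¹ * φ * k)) := by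
  obtain ⟨k, hk⟩ := exists_forall_mem_of_dense hG (fun i : Finset M × M => {k : G |
    ∃ σ : G, (∀ x ∈ (i.1 : Set M), σ • x = x) ∧
      (∀ x ∈ (i.1 : Set M), I i.1 (σ • i.2) ((φ⁻¹ * (k⁻¹ * φ * k)) • x)) ∧
      I i.1 (σ • i.2) ((φ⁻¹ * (k⁻¹ * φ * k)) • σ • i.2) ∧
      (∀ x ∈ (i.1 : Set M), I ((φ⁻¹ * (k⁻¹ * φ * k)) • i.1)
        ((φ⁻¹ * (k⁻¹ * φ * k)) • σ • i.2) x) ∧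
      I ((φ⁻¹ * (k⁻¹ * φ * k)) • i.1) ((φ⁻¹ * (k⁻¹ * φ * k)) • σ • i.2) (σ • i.2)}) (by
    rintro ⟨X, a₀⟩ e F hF
    by_cases ha₀ : a₀ ∈ X
    · refine ⟨e, F, hF, subset_rfl, fun _ _ => rfl, fun k _ => ⟨1, by simp, ?_⟩⟩
      simp only [one_smul]
      have h : ∀ g : G, g • a₀ ∈ g • (X : Set M) := fun g => Set.smul_mem_smul_set ha₀
      exact ⟨fun x _ => hI.of_mem _ _ _ ha₀, hI.of_mem _ _ _ ha₀, fun x _ => hI.of_mem _ _ _ (h _),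
        hI.of_mem _ _ _ (h _)⟩
    have hX : (X : Set M).Finite := X.finite_toSet
    obtain ⟨e', F', A, σ, hF', hA, h1, h2, h3, h4, h5, h6, h7, h8⟩ := hφ.exists_extension hI
      hLsmul e hF hX (a₀ := a₀) ha₀
    refine ⟨e', F', hF', h1, h2, fun k hk => ⟨σ, h3, ?_⟩⟩
    obtain ⟨h9, h10, -, h11, h12⟩ := h8 k hk
    simp only [mul_smul φ⁻¹]
    set ψ := k⁻¹ * φ * k with hψ
    set a := σ • a₀ with ha
    have hAf : (φ⁻¹ • A).Finite := hA.smul_set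
    have hψX : (ψ • (X : Set M)).Finite := hX.smul_set
    -- `a` is deleted from the base
    have i1 : ∀ c ∈ insert a (X : Set M), I (φ⁻¹ • A) (φ⁻¹ • ψ • a) c := by
      intro c hc
      -- deleting `a` requires that the third point is not `a` itself
      have hne : φ • c ≠ a := by
        rcases hc with rfl | hc
        exacts [(hLne _ _ h4).symm, h6 c hc]
      simpa using hI.smul φ⁻¹ _ _ _ (hdel (ψ • a) a (φ • c) A hA hne (hLsymm _ _ h10)
        (h12 _ (Set.smul_mem_smul_set hc)))
    have i2 : I X a (φ⁻¹ • ψ • a) := hI.trans_of_subset hX hAf Set.subset_union_right h7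
      (hI.symm _ _ _ (i1 a (Or.inl rfl)))
    have i3 : ∀ c ∈ insert a (X : Set M), I (φ⁻¹ • ψ • (X : Set M)) (φ⁻¹ • ψ • a) c :=
      fun c hc => hI.trans_of_subset hψX.smul_set hAf Set.subset_union_right
        (by rintro _ ⟨c, hc, rfl⟩; exact hI.smul _ _ _ _ (h11 c hc)) (i1 c hc)
    exact ⟨fun x hx => h7 _ (Set.smul_mem_smul_set (h9 x hx)), i2, fun x hx => i3 x (Or.inr hx),
      i3 a (Or.inl rfl)⟩)
  refine ⟨k, movesMaximally_of_point hI fun X hX a₀ => ?_⟩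
  simpa using hk (hX.toFinset, a₀)

end Commutators

/-! ### Coloured structures -/

section ColouredStructures

variable {Λ : Type u}

theorem hasColour_map {A B F : Type*} [(colourLanguage Λ).Structure A]
    [(colourLanguage Λ).Structure B] [FunLike F A B]
    [FirstOrder.Language.StrongHomClass (colourLanguage Λ) F A B] (f : F) (p : Λ) (x y : A) :
    HasColour p (f x) (f y) ↔ HasColour p x y := by
  have h : ![f x, f y] = f ∘ ![x, y] := by
    ext i
    fin_cases i <;> rfl
  unfold HasColour
  rw [h]
  exact FirstOrder.Language.StrongHomClass.map_rel f _ _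

theorem relMap_colour {A : Type*} [(colourLanguage Λ).Structure A] (p : Λ) (v : Fin 2 → A) :
    FirstOrder.Language.Structure.RelMap (L := colourLanguage Λ) (ColourRel.colour p) v ↔
      HasColour p (v 0) (v 1) := by
  unfold HasColour
  rw [show ![v 0, v 1] = v by ext i; fin_cases i <;> rfl]
  rfl

/-- A colour-preserving bijection, as an isomorphism. -/
noncomputable def colourEquiv {A B : Type*} [(colourLanguage Λ).Structure A]
    [(colourLanguage Λ).Structure B] (f : A → B) (hf : Function.Bijective f)
    (h : ∀ p x y, HasColour (Λ := Λ) p (f x) (f y) ↔ HasColour p x y) :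
    A ≃[colourLanguage Λ] B where
  toEquiv := Equiv.ofBijective f hf
  map_fun' := fun g => nomatch g
  map_rel' := fun {n} r v => by
    cases r with
    | colour p =>
      rw [relMap_colour, relMap_colour]
      exact h p _ _

/-- A colour-preserving injection, as an embedding. -/
def colourEmbedding {A B : Type*} [(colourLanguage Λ).Structure A]
    [(colourLanguage Λ).Structure B] (f : A → B) (hf : Function.Injective f)
    (h : ∀ p x y, HasColour (Λ := Λ) p (f x) (f y) ↔ HasColour p x y) :
    A ↪[colourLanguage Λ] B where
  toFun := f
  inj' := hf
  map_fun' := fun g => nomatch g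
  map_rel' := fun {n} r v => by
    cases r with
    | colour p =>
      rw [relMap_colour, relMap_colour]
      exact h p _ _

/-- The structure in which the colours are the given binary relations. -/
@[reducible] def structureOfRel {A : Type*} (rel : Λ → A → A → Prop) :
    (colourLanguage Λ).Structure A where
  funMap := fun g => nomatch g
  RelMap := fun {n} r => match n, r with
    | _, ColourRel.colour p => fun v => rel p (v 0) (v 1)

namespace IsCompleteStructure

variable {A : Type*} [(colourLanguage Λ).Structure A]

theorem ne (h : IsCompleteStructure Λ A) {p : Λ} {x y : A} (hp : HasColour p x y) : x ≠ y := by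
  rintro rfl
  exact h.irrefl p x hp

theorem eq (h : IsCompleteStructure Λ A) {p q : Λ} {x y : A} (hp : HasColour p x y)
    (hq : HasColour q x y) : p = q :=
  (h.existsUnique x y (h.ne hp)).unique hp hq

theorem iff_eq (h : IsCompleteStructure Λ A) {p q : Λ} {x y : A} (hp : HasColour p x y) :
    HasColour q x y ↔ q = p :=
  ⟨fun hq => h.eq hq hp, fun e => e ▸ hp⟩

/-- Between complete structures, it is enough that a map preserves colours in one direction. -/
theorem iff_of_imp {B : Type*} [(colourLanguage Λ).Structure B] (h : IsCompleteStructure Λ A)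
    (hB : IsCompleteStructure Λ B) {x y : A} {x' y' : B} (hxy : x = y → x' = y')
    (H : ∀ p : Λ, HasColour p x y → HasColour p x' y') (p : Λ) :
    HasColour p x' y' ↔ HasColour p x y := by
  refine ⟨fun hp => ?_, H p⟩
  obtain ⟨q, hq, -⟩ := h.existsUnique x y fun e => hB.ne hp (hxy e)
  rwa [hB.eq hp (H q hq)]

end IsCompleteStructure

end ColouredStructures

/-! ### Forbidden triangles -/

section ForbiddenTriangles

variable {Λ : Type u} {S : Set (Bundled.{w} (colourLanguage Λ).Structure)}

theorem IsForbiddenTriangle.rotate (hS : ∀ T ∈ S, IsTriangle T) {p q s : Λ}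
    (h : IsForbiddenTriangle S p q s) : IsForbiddenTriangle S q s p := by
  obtain ⟨T, hT, x, y, z, hxy, hyz, hxz, hp, hq, hs⟩ := h
  exact ⟨T, hT, y, z, x, hyz, hxz.symm, hxy.symm, hq, (hS T hT).1.symm _ _ _ hs,
    (hS T hT).1.symm _ _ _ hp⟩

theorem IsForbiddenTriangle.swap (hS : ∀ T ∈ S, IsTriangle T) {p q s : Λ}
    (h : IsForbiddenTriangle S p q s) : IsForbiddenTriangle S q p s := by
  obtain ⟨T, hT, x, y, z, hxy, hyz, hxz, hp, hq, hs⟩ := h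
  exact ⟨T, hT, z, y, x, hyz.symm, hxy.symm, hxz.symm, (hS T hT).1.symm _ _ _ hq,
    (hS T hT).1.symm _ _ _ hp, (hS T hT).1.symm _ _ _ hs⟩

theorem IsForbiddenTriangle.reverse (hS : ∀ T ∈ S, IsTriangle T) {p q s : Λ}
    (h : IsForbiddenTriangle S p q s) : IsForbiddenTriangle S s q p :=
  (h.rotate hS).swap hS

/-- A structure that embeds no member of `S` has no forbidden triangle: sending the vertices of
`T ∈ S` to three points with the same colours would be an embedding. -/
theorem not_isForbiddenTriangle {A : Type*} [(colourLanguage Λ).Structure A]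
    (hS : ∀ T ∈ S, IsTriangle T) (hA : IsCompleteStructure Λ A)
    (hemb : ∀ T ∈ S, IsEmpty (T ↪[colourLanguage Λ] A)) {p q s : Λ} {x y z : A}
    (hp : HasColour p x y) (hq : HasColour q y z) (hs : HasColour s x z) :
    ¬ IsForbiddenTriangle S p q s := by
  classical
  rintro ⟨T, hT, x', y', z', hxy, hyz, hxz, hp', hq', hs'⟩
  obtain ⟨hTc, hT3⟩ := hS T hT
  have hall : ∀ t : T, t = x' ∨ t = y' ∨ t = z' := by
    have hfin : Finite T := Nat.finite_of_card_ne_zero (by omega)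
    have := Fintype.ofFinite T
    rw [Nat.card_eq_fintype_card] at hT3
    have h3 : ({x', y', z'} : Finset T) = Finset.univ := Finset.eq_univ_of_card _ (by
      rw [hT3, Finset.card_eq_three]
      exact ⟨x', y', z', hxy, hxz, hyz, rfl⟩)
    intro t
    have : t ∈ ({x', y', z'} : Finset T) := h3 ▸ Finset.mem_univ t
    simpa using this
  have nxy := hA.ne hp
  have nyz := hA.ne hq
  have nxz := hA.ne hs
  let f : T → A := fun t => if t = x' then x else if t = y' then y else z
  have fx : f x' = x := by simp [f]
  have fy : f y' = y := by simp [f, hxy.symm]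
  have fz : f z' = z := by simp [f, hxz.symm, hyz.symm]
  refine (hemb T hT).false (colourEmbedding f ?_ ?_)
  · intro t t' h
    rcases hall t with rfl | rfl | rfl <;> rcases hall t' with rfl | rfl | rfl <;>
      simp_all
  · intro r t t'
    rcases hall t with rfl | rfl | rfl <;> rcases hall t' with rfl | rfl | rfl <;>
      simp only [fx, fy, fz, hA.irrefl, hTc.irrefl, hA.iff_eq hp, hA.iff_eq hq, hA.iff_eq hs,
        hTc.iff_eq hp', hTc.iff_eq hq', hTc.iff_eq hs', hA.iff_eq (hA.symm _ _ _ hp),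
        hA.iff_eq (hA.symm _ _ _ hq), hA.iff_eq (hA.symm _ _ _ hs),
        hTc.iff_eq (hTc.symm _ _ _ hp'), hTc.iff_eq (hTc.symm _ _ _ hq'),
        hTc.iff_eq (hTc.symm _ _ _ hs')]

theorem mem_forbC_of_not_isForbiddenTriangle (hS : ∀ T ∈ S, IsTriangle T)
    (A : Bundled.{w} (colourLanguage Λ).Structure) [Finite A] (hA : IsCompleteStructure Λ A)
    (h : ∀ (p q s : Λ) (x y z : A), HasColour p x y → HasColour q y z → HasColour s x z →
      ¬ IsForbiddenTriangle S p q s) : A ∈ forbC S := by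
  classical
  refine ⟨inferInstance, hA, fun T hT => ⟨fun f => ?_⟩⟩
  obtain ⟨hTc, hT3⟩ := hS T hT
  have hfin : Finite T := Nat.finite_of_card_ne_zero (by omega)
  have := Fintype.ofFinite T
  rw [Nat.card_eq_fintype_card, ← Finset.card_univ, Finset.card_eq_three] at hT3
  obtain ⟨x, y, z, hxy, hxz, hyz, -⟩ := hT3
  obtain ⟨p, hp, -⟩ := hTc.existsUnique x y hxy
  obtain ⟨q, hq, -⟩ := hTc.existsUnique y z hyz
  obtain ⟨s, hs, -⟩ := hTc.existsUnique x z hxz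
  exact h p q s (f x) (f y) (f z) ((hasColour_map f _ _ _).2 hp) ((hasColour_map f _ _ _).2 hq)
    ((hasColour_map f _ _ _).2 hs) ⟨T, hT, x, y, z, hxy, hyz, hxz, hp, hq, hs⟩

end ForbiddenTriangles

/-! ### The action of the automorphism group -/

section Automorphisms

open FirstOrder

variable {Λ : Type u} {M : Type w} [(colourLanguage Λ).Structure M]

/-- Automorphisms act on the structure by evaluation. -/
instance structureAutAction {L : Language} {M : Type*} [L.Structure M] :
    MulAction (M ≃[L] M) M where
  smul g x := g x
  one_smul _ := rfl
  mul_smul _ _ _ := rfl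

instance {L : Language} {M : Type*} [L.Structure M] : FaithfulSMul (M ≃[L] M) M where
  eq_of_smul_eq_smul h := Language.Equiv.ext h

theorem hasColour_smul (g : M ≃[colourLanguage Λ] M) {p : Λ} {x y : M} :
    HasColour p (g • x) (g • y) ↔ HasColour p x y :=
  hasColour_map g p x y

theorem isClosedAction_aut : IsClosedAction (M ≃[colourLanguage Λ] M) M := by
  intro s F hF hs hdom hran
  choose n hn using hdom
  have hk : ∀ x m, x ∈ F m → s (n x) • x = s m • x := fun x m hx => by
    rw [← hs _ _ (le_max_left (n x) m) x (hn x), ← hs _ _ (le_max_right (n x) m) x hx]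
  have hpair : ∀ x y, ∃ m, s (n x) • x = s m • x ∧ s (n y) • y = s m • y := fun x y =>
    ⟨max (n x) (n y), hk x _ (hF (le_max_left _ _) (hn x)), hk y _ (hF (le_max_right _ _) (hn y))⟩
  refine ⟨colourEquiv (fun x => s (n x) • x) ⟨?_, ?_⟩ ?_, fun m x hx => hk x m hx⟩
  · intro x y (h : s (n x) • x = s (n y) • y)
    obtain ⟨m, h1, h2⟩ := hpair x y
    rw [h1, h2] at h
    exact smul_left_cancel _ h
  · intro y
    obtain ⟨m, x, hx, rfl⟩ := hran y
    exact ⟨x, hk x m hx⟩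
  · intro p x y
    obtain ⟨m, h1, h2⟩ := hpair x y
    simp only [h1, h2, hasColour_smul]

end Automorphisms

/-! ### The Fraïssé limit -/

section FraisseLimit

open FirstOrder

variable {Λ : Type u} {S : Set (Bundled.{w} (colourLanguage Λ).Structure)}
  {M : Type w} [(colourLanguage Λ).Structure M]

/-- The substructure of `M` on the set `F`. -/
abbrev inducedSubstructure (Λ : Type u) {M : Type w} [(colourLanguage Λ).Structure M] (F : Set M) :
    (colourLanguage Λ).Substructure M :=
  Language.Substructure.closure (colourLanguage Λ) F

/-- The substructure of `M` on the set `F`, as a bundled structure. -/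
abbrev inducedBundled (Λ : Type u) {M : Type w} [(colourLanguage Λ).Structure M] (F : Set M) :
    Bundled.{w} (colourLanguage Λ).Structure :=
  ⟨inducedSubstructure Λ F, inferInstance⟩

theorem mem_inducedSubstructure {F : Set M} {x : M} : x ∈ inducedSubstructure Λ F ↔ x ∈ F :=
  Language.Substructure.mem_closure_iff_of_isRelational _ _ _

variable {m : ℕ} {R : Fin m → Λ}

/-- Independence of points in the Fraïssé limit. -/
theorem indep_singleton_iff {B : Set M} {a c : M} :
    Indep S R {a} B {c} ↔ a ∈ B ∨ c ∈ B ∨ a ≠ c ∧ ∃ i : Fin m,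
      IsPermitted S B a c (R i) ∧ (∀ j < i, ¬ IsPermitted S B a c (R j)) ∧
        HasColour (R i) a c := by
  unfold Indep IsPrioritisedIn
  constructor
  · rintro ⟨h1, h2⟩
    by_cases ha : a ∈ B
    · exact Or.inl ha
    by_cases hcB : c ∈ B
    · exact Or.inr (Or.inl hcB)
    refine Or.inr (Or.inr ⟨?_, h2 a ⟨Or.inl rfl, ha⟩ c ⟨Or.inr rfl, hcB⟩⟩)
    rintro rfl
    exact ha (h1 ▸ ⟨Or.inl rfl, Or.inr rfl⟩)
  · intro h
    constructor
    · ext x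
      constructor
      · rintro ⟨rfl | h1, h2 | rfl⟩
        · exact h2
        · rcases h with h | h | h
          exacts [h, h, (h.1 rfl).elim]
        · exact h1
        · exact h1
      · exact fun hx => ⟨Or.inr hx, Or.inl hx⟩
    · rintro x ⟨rfl | h1, h2⟩ y ⟨h3 | rfl, h4⟩
      · exact (h4 h3).elim
      · rcases h with h | h | h
        exacts [(h2 h).elim, (h4 h).elim, h.2]
      all_goals exact (h2 h1).elim

variable [Countable M]

theorem inducedBundled_mem_forbC (hM : Language.IsFraisseLimit (forbC S) M) {F : Set M}
    (hF : F.Finite) : inducedBundled Λ F ∈ forbC S := by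
  rw [← hM.age]
  exact Language.age.fg_substructure (Language.Substructure.fg_closure hF)

theorem exists_embedding (hM : Language.IsFraisseLimit (forbC S) M)
    {A : Bundled.{w} (colourLanguage Λ).Structure} (hA : A ∈ forbC S) :
    Nonempty (A ↪[colourLanguage Λ] M) := by
  rw [← hM.age] at hA
  exact hA.2

/-- A triple of points of `M`, as points of a structure in `Forb_c(S)`. -/
theorem exists_triple (hM : Language.IsFraisseLimit (forbC S) M) (x y z : M) :
    ∃ A ∈ forbC S, ∃ (f : A ↪[colourLanguage Λ] M) (x' y' z' : A), f x' = x ∧ f y' = y ∧ f z' = z :=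
  ⟨_, inducedBundled_mem_forbC hM (Set.toFinite {x, y, z}), Language.Substructure.subtype _,
    ⟨x, mem_inducedSubstructure.2 (by simp)⟩, ⟨y, mem_inducedSubstructure.2 (by simp)⟩,
    ⟨z, mem_inducedSubstructure.2 (by simp)⟩, rfl, rfl, rfl⟩

theorem isCompleteStructure_limit (hM : Language.IsFraisseLimit (forbC S) M) :
    IsCompleteStructure Λ M where
  symm p x y h := by
    obtain ⟨A, hA, f, x, y, -, rfl, rfl, -⟩ := exists_triple hM x y y
    rw [hasColour_map] at h ⊢
    exact hA.2.1.symm _ _ _ h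
  irrefl p x h := by
    obtain ⟨A, hA, f, x, -, -, rfl, -, -⟩ := exists_triple hM x x x
    rw [hasColour_map] at h
    exact hA.2.1.irrefl _ _ h
  existsUnique x y hxy := by
    obtain ⟨A, hA, f, x, y, -, rfl, rfl, -⟩ := exists_triple hM x y y
    simp only [hasColour_map]
    exact hA.2.1.existsUnique x y fun h => hxy (h ▸ rfl)

theorem not_isForbiddenTriangle_limit (hS : ∀ T ∈ S, IsTriangle T)
    (hM : Language.IsFraisseLimit (forbC S) M) {p q s : Λ} {x y z : M}
    (hp : HasColour p x y) (hq : HasColour q y z) (hs : HasColour s x z) :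
    ¬ IsForbiddenTriangle S p q s := by
  obtain ⟨A, hA, f, x, y, z, rfl, rfl, rfl⟩ := exists_triple hM x y z
  rw [hasColour_map] at hp hq hs
  exact not_isForbiddenTriangle hS hA.2.1 hA.2.2 hp hq hs

/-- Homogeneity: a colour-preserving map on a finite set extends to an automorphism. -/
theorem exists_aut (hM : Language.IsFraisseLimit (forbC S) M) {F : Set M} (hF : F.Finite)
    (φ : M → M) (hφ : ∀ x ∈ F, ∀ y ∈ F, ∀ p : Λ, HasColour p x y → HasColour p (φ x) (φ y)) :
    ∃ g : M ≃[colourLanguage Λ] M, ∀ x ∈ F, g • x = φ x := by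
  have hc := isCompleteStructure_limit hM
  have hφ' : ∀ x ∈ F, ∀ y ∈ F, ∀ p : Λ, HasColour p (φ x) (φ y) ↔ HasColour p x y :=
    fun x hx y hy => hc.iff_of_imp hc (fun h => h ▸ rfl) (hφ x hx y hy)
  obtain ⟨g, hg⟩ := hM.ultrahomogeneous (inducedSubstructure Λ F)
    (Language.Substructure.fg_closure hF) (colourEmbedding (fun x => φ x) (by
      rintro ⟨x, hx⟩ ⟨y, hy⟩ h
      by_contra hne
      obtain ⟨p, hp, -⟩ := hc.existsUnique x y fun e => hne (Subtype.ext e)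
      exact hc.ne (hφ x (mem_inducedSubstructure.1 hx) y (mem_inducedSubstructure.1 hy) p hp) h)
    fun p x y => by
      rw [hφ' x (mem_inducedSubstructure.1 x.2) y (mem_inducedSubstructure.1 y.2),
        ← hasColour_map (Language.Substructure.subtype (inducedSubstructure Λ F)) p x y]
      rfl)
  exact ⟨g, fun x hx => (DFunLike.congr_fun hg ⟨x, mem_inducedSubstructure.2 hx⟩).symm⟩

/-- A finite complete structure without forbidden triangles, given by its colours, embeds. -/
theorem exists_embedding_of_rel (hS : ∀ T ∈ S, IsTriangle T)
    (hM : Language.IsFraisseLimit (forbC S) M) {A : Type w} [Finite A] (rel : Λ → A → A → Prop)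
    (hsymm : ∀ p x y, rel p x y → rel p y x) (hirrefl : ∀ p x, ¬ rel p x x)
    (huniq : ∀ x y, x ≠ y → ∃! p, rel p x y)
    (hforb : ∀ p q s x y z, rel p x y → rel q y z → rel s x z → ¬ IsForbiddenTriangle S p q s) :
    ∃ f : A → M, ∀ p x y, HasColour p (f x) (f y) ↔ rel p x y := by
  let _ : (colourLanguage Λ).Structure A := structureOfRel rel
  obtain ⟨f⟩ := exists_embedding hM (mem_forbC_of_not_isForbiddenTriangle hS
    (⟨A, inferInstance⟩ : Bundled.{w} (colourLanguage Λ).Structure) ⟨hsymm, hirrefl, huniq⟩ hforb)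
  exact ⟨f, fun p x y => hasColour_map f p x y⟩

/-- A one-point extension of a finite subset of `M` that forms no forbidden triangle is realised. -/
theorem exists_point (hS : ∀ T ∈ S, IsTriangle T) (hM : Language.IsFraisseLimit (forbC S) M)
    {F : Set M} (hF : F.Finite) (τ : M → Λ)
    (hτ : ∀ x ∈ F, ∀ y ∈ F, ∀ p, HasColour p x y → ¬ IsForbiddenTriangle S (τ x) p (τ y)) :
    ∃ z, ∀ x ∈ F, HasColour (τ x) z x := by
  classical
  have hc := isCompleteStructure_limit hM
  let rel : Λ → Option F → Option F → Prop := fun p x y =>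
    match x, y with
    | none, none => False
    | none, some y => p = τ y
    | some x, none => p = τ x
    | some x, some y => HasColour p (x : M) y
  have : Finite F := hF
  obtain ⟨f, hf⟩ := exists_embedding_of_rel hS hM rel
    (by
      rintro p (_ | x) (_ | y) h
      exacts [h, h, h, hc.symm _ _ _ h])
    (by
      rintro p (_ | x) h
      exacts [h, hc.irrefl _ _ h])
    (by
      rintro (_ | x) (_ | y) h
      · exact (h rfl).elim
      · exact ⟨τ y, rfl, fun _ h => h⟩
      · exact ⟨τ x, rfl, fun _ h => h⟩
      · exact hc.existsUnique x y fun e => h (congrArg some (Subtype.ext e)))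
    (by
      rintro p q s (_ | x) (_ | y) (_ | z) hp hq hs h
      · exact hp
      · exact hp
      · exact hs
      · cases hp; cases hs
        exact hτ y y.2 z z.2 q hq h
      · exact hq
      · cases hp; cases hq
        exact hτ x x.2 z z.2 s hs ((h.swap hS).rotate hS)
      · cases hq; cases hs
        exact hτ x x.2 y y.2 p hp ((h.rotate hS).rotate hS)
      · exact not_isForbiddenTriangle_limit hS hM hp hq hs h)
  obtain ⟨g, hg⟩ := exists_aut hM hF (fun x => if h : x ∈ F then f (some ⟨x, h⟩) else x) (by
    intro x hx y hy p h
    simp only [hx, hy, dif_pos]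
    exact (hf _ _ _).2 h)
  refine ⟨g⁻¹ • f none, fun x hx => ?_⟩
  have h : g⁻¹ • f (some ⟨x, hx⟩) = x := by rw [inv_smul_eq_iff, hg x hx, dif_pos hx]
  conv_rhs => rw [← h]
  rw [hasColour_smul, hf]

theorem isPermitted_iff_of_colours {D D' : Type*} [(colourLanguage Λ).Structure D]
    [(colourLanguage Λ).Structure D'] {B : Set D} {B' : Set D'} {a c : D} {a' c' : D'}
    (φ : D → D') (hφ : B' = φ '' B) (ha : ∀ b ∈ B, ∀ q : Λ, HasColour q a' (φ b) ↔ HasColour q a b)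
    (hc : ∀ b ∈ B, ∀ q : Λ, HasColour q (φ b) c' ↔ HasColour q b c) (p : Λ) :
    IsPermitted S B' a' c' p ↔ IsPermitted S B a c p := by
  subst hφ
  unfold IsPermitted
  rw [Set.forall_mem_image]
  refine forall₂_congr fun b hb => forall₂_congr fun q s => ?_
  rw [ha b hb, hc b hb]

theorem IsPermitted.symm (hS : ∀ T ∈ S, IsTriangle T) {D : Type*} [(colourLanguage Λ).Structure D]
    (hD : IsCompleteStructure Λ D) {B : Set D} {a c : D} {p : Λ} (h : IsPermitted S B a c p) :
    IsPermitted S B c a p := fun b hb q s hq hs hf =>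
  h b hb s q (hD.symm _ _ _ hs) (hD.symm _ _ _ hq) (hf.swap hS)

/-- The first permitted colour is determined by the colours to the base. -/
theorem stationarity_colour (hM : Language.IsFraisseLimit (forbC S) M) {B : Set M} {a a' c : M}
    (ha : a ∉ B) (ha' : a' ∉ B) (hcB : c ∉ B)
    (haa' : ∀ b ∈ B, ∀ q : Λ, HasColour q a' b ↔ HasColour q a b)
    (h : Indep S R {a} B {c}) (h' : Indep S R {a'} B {c}) {p : Λ} (hp : HasColour p a c) :
    HasColour p a' c := by
  have hper := fun p => isPermitted_iff_of_colours (S := S) (c := c) (c' := c) (B := B) (B' := B) id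
    (by simp) haa' (fun _ _ _ => Iff.rfl) p
  rw [indep_singleton_iff] at h h'
  obtain ⟨-, i, i1, i2, i3⟩ := (h.resolve_left ha).resolve_left hcB
  obtain ⟨-, j, j1, j2, j3⟩ := (h'.resolve_left ha').resolve_left hcB
  have hij : i = j := le_antisymm (not_lt.1 fun hlt => i2 j hlt ((hper _).1 j1))
    (not_lt.1 fun hlt => j2 i hlt ((hper _).2 i1))
  subst hij
  rwa [(isCompleteStructure_limit hM).eq hp i3]

/-- Every finite set `A` has a copy over `B` that is independent from `C` over `B`: realise the
prioritised amalgam of `A ∪ B` and `B ∪ C` in `M`, and move its second part back to `B ∪ C`. -/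
theorem exists_indep_copy (hM : Language.IsFraisseLimit (forbC S) M)
    (hprio : IsPrioritisedClass S R) {A B C : Set M} (hA : A.Finite) (hB : B.Finite)
    (hC : C.Finite) :
    ∃ g : M ≃[colourLanguage Λ] M, (∀ b ∈ B, g • b = b) ∧
      ∀ a ∈ A, ∀ c ∈ C, Indep S R {g • a} B {c} := by
  classical
  have hBA : inducedSubstructure Λ B ≤ inducedSubstructure Λ (A ∪ B) :=
    Language.Substructure.closure_mono Set.subset_union_right
  have hBC : inducedSubstructure Λ B ≤ inducedSubstructure Λ (B ∪ C) :=
    Language.Substructure.closure_mono Set.subset_union_left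
  obtain ⟨D, hD, g₁, g₂, hg, -, hind, hcol⟩ := hprio.amalgam _ _ _
    (inducedBundled_mem_forbC hM (hA.union hB)) (inducedBundled_mem_forbC hM hB)
    (inducedBundled_mem_forbC hM (hB.union hC)) (Language.Substructure.inclusion hBA)
    (Language.Substructure.inclusion hBC)
  obtain ⟨ψ⟩ := exists_embedding hM hD
  have mA : ∀ x ∈ A ∪ B, x ∈ inducedSubstructure Λ (A ∪ B) := fun x => mem_inducedSubstructure.2
  have mC : ∀ x ∈ B ∪ C, x ∈ inducedSubstructure Λ (B ∪ C) := fun x => mem_inducedSubstructure.2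
  have mB : ∀ x ∈ B, x ∈ inducedSubstructure Λ B := fun x => mem_inducedSubstructure.2
  -- the two parts of the amalgam, as copies of `A ∪ B` and `B ∪ C` in `M`
  let G₁ : M → M := fun x => if h : x ∈ A ∪ B then ψ (g₁ ⟨x, mA x h⟩) else x
  let G₂ : M → M := fun x => if h : x ∈ B ∪ C then ψ (g₂ ⟨x, mC x h⟩) else x
  have hG₁ : ∀ x (h : x ∈ A ∪ B), G₁ x = ψ (g₁ ⟨x, mA x h⟩) := fun x h => dif_pos h
  have hG₂ : ∀ x (h : x ∈ B ∪ C), G₂ x = ψ (g₂ ⟨x, mC x h⟩) := fun x h => dif_pos h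
  have hsub : ∀ (F : Set M) (x y : inducedSubstructure Λ F) (p : Λ),
      HasColour p (x : M) y ↔ HasColour p x y := fun F x y p =>
    hasColour_map (Language.Substructure.subtype (inducedSubstructure Λ F)) p x y
  obtain ⟨σ, hσ⟩ := exists_aut hM (hA.union hB) G₁ (by
    intro x hx y hy p h
    rwa [hG₁ x hx, hG₁ y hy, hasColour_map, hasColour_map, ← hsub])
  obtain ⟨θ, hθ⟩ := exists_aut hM (hB.union hC) G₂ (by
    intro x hx y hy p h
    rwa [hG₂ x hx, hG₂ y hy, hasColour_map, hasColour_map, ← hsub])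
  have hσθ : ∀ b ∈ B, σ • b = θ • b := fun b hb => by
    rw [hσ b (Or.inr hb), hθ b (Or.inl hb), hG₁ b (Or.inr hb), hG₂ b (Or.inl hb)]
    exact congrArg ψ (hg ⟨b, mB b hb⟩)
  have hfix : ∀ b ∈ B, (θ⁻¹ * σ) • b = b := fun b hb => by
    rw [mul_smul, hσθ b hb, inv_smul_smul]
  refine ⟨θ⁻¹ * σ, hfix, fun a ha c hc => ?_⟩
  rw [indep_singleton_iff]
  by_cases haB : a ∈ B
  · exact Or.inl (by rwa [hfix a haB])
  by_cases hcB : c ∈ B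
  · exact Or.inr (Or.inl hcB)
  refine Or.inr (Or.inr ?_)
  have e1 : ∀ x (h : x ∈ A ∪ B), (θ⁻¹ * σ) • x = θ⁻¹ • ψ (g₁ ⟨x, mA x h⟩) := fun x h => by
    rw [mul_smul, hσ x h, hG₁ x h]
  have e2 : ∀ x (h : x ∈ B ∪ C), x = θ⁻¹ • ψ (g₂ ⟨x, mC x h⟩) := fun x h => by
    rw [eq_inv_smul_iff, hθ x h, hG₂ x h]
  set a' := g₁ ⟨a, mA a (Or.inl ha)⟩ with ha'
  set c' := g₂ ⟨c, mC c (Or.inr hc)⟩ with hc'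
  have hincl : ∀ b (hb : b ∈ B), Language.Substructure.inclusion hBA ⟨b, mB b hb⟩ =
      ⟨b, mA b (Or.inr hb)⟩ := fun b hb => rfl
  have ha'B : a' ∉ Set.range fun b => g₁ (Language.Substructure.inclusion hBA b) := by
    rintro ⟨⟨b, hb⟩, h⟩
    have hba : b = a := congrArg Subtype.val (g₁.injective h)
    exact haB (hba ▸ mem_inducedSubstructure.1 hb)
  have hc'B : c' ∉ Set.range fun b => g₁ (Language.Substructure.inclusion hBA b) := by
    rintro ⟨⟨b, hb⟩, h⟩
    have hbc : b = c := congrArg Subtype.val (g₂.injective ((hg ⟨b, hb⟩).symm.trans h))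
    exact hcB (hbc ▸ mem_inducedSubstructure.1 hb)
  have hae : (θ⁻¹ * σ) • a = θ⁻¹ • ψ a' := e1 a (Or.inl ha)
  have hce : c = θ⁻¹ • ψ c' := e2 c (Or.inr hc)
  have hcolD : ∀ (x y : D) (p : Λ), HasColour p (θ⁻¹ • ψ x) (θ⁻¹ • ψ y) ↔ HasColour p x y :=
    fun x y p => by rw [hasColour_smul, hasColour_map]
  have hBimg : B = (fun x : D => θ⁻¹ • ψ x) ''
      Set.range fun b => g₁ (Language.Substructure.inclusion hBA b) := by
    rw [← Set.range_comp]
    ext b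
    constructor
    · intro hb
      exact ⟨⟨b, mB b hb⟩, ((e1 b (Or.inr hb)).symm.trans (hfix b hb))⟩
    · rintro ⟨⟨b, hb⟩, rfl⟩
      have hb' := mem_inducedSubstructure.1 hb
      exact Set.mem_of_eq_of_mem ((e1 b (Or.inr hb')).symm.trans (hfix b hb')) hb'
  have hper := fun p => isPermitted_iff_of_colours (S := S) (a := a') (c := c')
    (a' := θ⁻¹ • ψ a') (c' := θ⁻¹ • ψ c') (fun x : D => θ⁻¹ • ψ x) hBimg
    (fun b _ q => hcolD _ _ q) (fun b _ q => hcolD _ _ q) p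
  obtain ⟨i, i1, i2, i3⟩ := hcol a' ⟨⟨_, rfl⟩, ha'B⟩ c' ⟨⟨_, rfl⟩, hc'B⟩
  rw [hae]
  constructor
  · intro h
    rw [hce] at h
    have h' : a' = c' := ψ.injective (smul_left_cancel _ h)
    exact ha'B (hind ▸ ⟨⟨_, rfl⟩, h' ▸ ⟨_, rfl⟩⟩)
  · rw [hce]
    exact ⟨i, (hper _).2 i1, fun j hj h => i2 j hj ((hper _).1 h), (hcolD _ _ _).2 i3⟩

/-- The prioritised amalgams give a stationary independence relation. Copies exist because the
amalgams belong to the class, and they are unique because the colours between the two parts of an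
amalgam only depend on the colours to the base. For monotonicity in the base, a colour that occurs
in `M` is permitted over every base, so it remains the first one permitted when the base grows. -/
theorem stationaryIndep_limit (hS : ∀ T ∈ S, IsTriangle T)
    (hM : Language.IsFraisseLimit (forbC S) M) (hprio : IsPrioritisedClass S R) :
    StationaryIndep (M ≃[colourLanguage Λ] M) fun (B : Set M) a c => Indep S R {a} B {c} where
  smul g B a c h := by
    rw [indep_singleton_iff] at h ⊢
    rw [Set.smul_mem_smul_set_iff, Set.smul_mem_smul_set_iff, ne_eq,
      (MulAction.injective g).eq_iff]
    have hper := fun p => isPermitted_iff_of_colours (S := S) (a := a) (c := c) (a' := g • a)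
      (c' := g • c) (fun x => g • x) (B := B) (B' := g • B) rfl (fun b _ q => hasColour_smul g)
      (fun b _ q => hasColour_smul g) p
    simpa only [hper, hasColour_smul] using h
  symm B a c h := by
    rw [indep_singleton_iff] at h ⊢
    have hc := isCompleteStructure_limit hM
    rcases h with h | h | ⟨h, i, i1, i2, i3⟩
    · exact Or.inr (Or.inl h)
    · exact Or.inl h
    · exact Or.inr (Or.inr ⟨h.symm, i, i1.symm hS hc, fun j hj hp => i2 j hj (hp.symm hS hc),
        hc.symm _ _ _ i3⟩)
  mono B B' a c hBB' h := by
    rw [indep_singleton_iff] at h ⊢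
    rcases h with h | h | ⟨h, i, i1, i2, i3⟩
    · exact Or.inl (hBB' h)
    · exact Or.inr (Or.inl (hBB' h))
    · exact Or.inr (Or.inr ⟨h, i, fun b _ q s hq hs => not_isForbiddenTriangle_limit hS hM hq hs i3,
        fun j hj hp => i2 j hj fun b hb => hp b (hBB' hb), i3⟩)
  of_mem B a c h := indep_singleton_iff.2 (Or.inl h)
  mem_of_self B a h := by
    rcases indep_singleton_iff.1 h with h | h | h
    exacts [h, h, (h.1 rfl).elim]
  exist A B C hA hB hC := exists_indep_copy hM hprio hA hB hC
  stat A B C g hA hB hC hgB h h' := by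
    classical
    have hc := isCompleteStructure_limit hM
    have hgB' : ∀ a, a ∉ B → g • a ∉ B := fun a ha hga =>
      ha (smul_left_cancel g (hgB _ hga) ▸ hga)
    have key : ∀ x ∈ A ∪ B, ∀ y ∉ A ∪ B, y ∈ C → ∀ p : Λ, HasColour p x y →
        HasColour p (g • x) y := by
      intro x hx y hy hyC p hp
      by_cases hxB : x ∈ B
      · rwa [hgB x hxB]
      have hxA := hx.resolve_right hxB
      refine stationarity_colour hM hxB (hgB' x hxB) (fun hyB => hy (Or.inr hyB))
        (fun b hb q => ?_) (h x hxA y hyC) (h' x hxA y hyC) hp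
      conv_lhs => rw [← hgB b hb]
      exact hasColour_smul g
    obtain ⟨g', hg'⟩ := exists_aut hM ((hA.union hB).union hC)
      (fun x => if x ∈ A ∪ B then g • x else x) (by
        intro x hx y hy p hp
        by_cases hxA : x ∈ A ∪ B <;> by_cases hyA : y ∈ A ∪ B <;> simp only [hxA, hyA, if_true,
          if_false]
        · rwa [hasColour_smul]
        · exact key x hxA y hyA (hy.resolve_left hyA) p hp
        · exact hc.symm _ _ _ (key y hyA x hxA (hx.resolve_left hxA) p (hc.symm _ _ _ hp))
        · exact hp)
    refine ⟨g', fun b hb => ?_, fun c hcC => ?_, fun a ha => ?_⟩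
    · rw [hg' b (Or.inl (Or.inr hb)), if_pos (Set.mem_union_right A hb), hgB b hb]
    · rw [hg' c (Or.inr hcC)]
      split_ifs with hcA
      · rcases hcA with hcA | hcB
        · exact hgB c (by
            rcases indep_singleton_iff.1 (h c hcA c hcC) with h | h | h
            exacts [h, h, (h.1 rfl).elim])
        · exact hgB c hcB
      · rfl
    · rw [hg' a (Or.inl (Or.inl ha)), if_pos (Set.mem_union_left B ha)]

end FraisseLimit

/-! ### Nontrivial automorphisms move realisations of all types -/

section MovedPoints

open FirstOrder

variable {Λ : Type u} {S : Set (Bundled.{w} (colourLanguage Λ).Structure)}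
  {M : Type w} [(colourLanguage Λ).Structure M] [Countable M] {m : ℕ} {R : Fin m → Λ}

theorem nonempty_limit (hS : ∀ T ∈ S, IsTriangle T) (hM : Language.IsFraisseLimit (forbC S) M) :
    Nonempty M := by
  obtain ⟨f, -⟩ := exists_embedding_of_rel hS hM (A := PUnit) (fun _ _ _ => False)
    (fun _ _ _ h => h) (fun _ _ h => h) (fun x y h => (h rfl).elim) (fun _ _ _ _ _ _ h => h.elim)
  exact ⟨f ⟨⟩⟩

/-- There is a solution: two points that are independent over the empty set have a colour in the
list. -/
theorem solutions_pos (hS : ∀ T ∈ S, IsTriangle T) (hM : Language.IsFraisseLimit (forbC S) M)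
    (hprio : IsPrioritisedClass S R) : 0 < m := by
  obtain ⟨a⟩ := nonempty_limit hS hM
  obtain ⟨g, -, h⟩ := exists_indep_copy hM hprio (Set.finite_singleton a) Set.finite_empty
    (Set.finite_singleton a)
  rcases indep_singleton_iff.1 (h a rfl a rfl) with h | h | ⟨-, i, -⟩
  exacts [h.elim, h.elim, i.pos]

/-- Two different colours `P` and `t` such that no forbidden triangle has two edges coloured `P`, or
an edge coloured `P` and an edge coloured `t`: here `P` is the first solution, and `t` is the second
one, or any other colour if `P` is the only solution. In the latter case all amalgams use `P`, so
that no forbidden triangle has an edge coloured `P`. -/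
theorem exists_neutral_pair (hS : ∀ T ∈ S, IsTriangle T)
    (hM : Language.IsFraisseLimit (forbC S) M) (hprio : IsPrioritisedClass S R)
    (hcond : MainCondition S R M) :
    ∃ P t : Λ, P ≠ t ∧ (∀ s, ¬ IsForbiddenTriangle S P s P) ∧
      (∀ s, ¬ IsForbiddenTriangle S P s t) ∧ ∀ s, ¬ IsForbiddenTriangle S t s P := by
  have hm := solutions_pos hS hM hprio
  have rot : ∀ {p q s : Λ}, IsForbiddenTriangle S p s q → IsForbiddenTriangle S p q s :=
    fun h => (h.swap hS).rotate hS
  have hPP : ∀ s, ¬ IsForbiddenTriangle S (R ⟨0, hm⟩) s (R ⟨0, hm⟩) := fun s h =>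
    hcond.no_pair ⟨0, hm⟩ ⟨0, hm⟩ rfl zero_le_one ⟨s, rot h⟩
  suffices h : ∃ t, R ⟨0, hm⟩ ≠ t ∧ ∀ s, ¬ IsForbiddenTriangle S (R ⟨0, hm⟩) s t by
    obtain ⟨t, h1, h2⟩ := h
    exact ⟨_, t, h1, hPP, h2, fun s h => h2 s (h.reverse hS)⟩
  by_cases hm1 : 1 < m
  · exact ⟨R ⟨1, hm1⟩, fun h => by simpa using hprio.injective h, fun s h =>
      hcond.no_pair ⟨0, hm⟩ ⟨1, hm1⟩ rfl le_rfl ⟨s, rot h⟩⟩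
  obtain ⟨t, ht⟩ := not_forall.1 hprio.proper
  refine ⟨t, fun h => ht ⟨_, h⟩, fun s hf => ?_⟩
  have hc := isCompleteStructure_limit hM
  obtain ⟨b⟩ := nonempty_limit hS hM
  have hpt : ∀ p : Λ, ∃ a, HasColour p a b := fun p => by
    obtain ⟨a, ha⟩ := exists_point hS hM (Set.finite_singleton b) (fun _ => p) (by
      rintro x rfl y rfl q h
      exact (hc.irrefl _ _ h).elim)
    exact ⟨a, ha b rfl⟩
  obtain ⟨a, ha⟩ := hpt t
  obtain ⟨c, hcs⟩ := hpt s
  obtain ⟨g, hg, h⟩ := exists_indep_copy hM hprio (Set.finite_singleton a) (Set.finite_singleton b)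
    (Set.finite_singleton c)
  have hga : HasColour t (g • a) b := by
    rw [← hg b rfl, hasColour_smul]
    exact ha
  rcases indep_singleton_iff.1 (h a rfl c rfl) with h | h | ⟨-, i, hi, -⟩
  · exact hc.ne hga h
  · exact hc.ne hcs h
  · -- `P` is the only solution, so it is permitted for `a` and `c` over `b`
    have h0 : i = ⟨0, hm⟩ := Fin.ext (by have := i.2; simp only; omega)
    subst h0
    exact hi b rfl t s hga (hc.symm _ _ _ hcs) (hf.reverse hS)

/-- If `g z = z` for every point `z` all whose colours to a finite set `F` are `P`, then `g = 1`. -/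
theorem eq_one_of_fixes_generic (hS : ∀ T ∈ S, IsTriangle T)
    (hM : Language.IsFraisseLimit (forbC S) M) {P t : Λ} (hPt : P ≠ t)
    (hPP : ∀ s, ¬ IsForbiddenTriangle S P s P) (hPt' : ∀ s, ¬ IsForbiddenTriangle S P s t)
    (htP : ∀ s, ¬ IsForbiddenTriangle S t s P) {g : M ≃[colourLanguage Λ] M} {F : Set M}
    (hF : F.Finite) (hg : ∀ z, (∀ x ∈ F, HasColour P z x) → g • z = z) : g = 1 := by
  classical
  have hc := isCompleteStructure_limit hM
  -- points with colour `t` to `b`, and colour `P` to the rest of a finite set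
  have hpt : ∀ (E : Set M), E.Finite → ∀ b, ∃ z, HasColour t z b ∧
      ∀ x ∈ E, x ≠ b → HasColour P z x := by
    intro E hE b
    obtain ⟨z, hz⟩ := exists_point hS hM (hE.insert b) (fun x => if x = b then t else P) (by
      intro x _ y _ p h
      by_cases hx : x = b <;> by_cases hy : y = b <;> simp only [hx, hy, if_true, if_false]
      · exact ((hc.ne h) (hx.trans hy.symm)).elim
      · exact htP p
      · exact hPt' p
      · exact hPP p)
    refine ⟨z, by simpa using hz b (Or.inl rfl), fun x hx hxb => ?_⟩
    simpa [hxb] using hz x (Or.inr hx)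
  have hmove : ∀ b, (∀ z, HasColour t z b → (∀ x ∈ F, x ≠ b → HasColour P z x) → g • z = z) →
      g • b = b := by
    intro b hb
    by_contra hne
    obtain ⟨z, hz1, hz2⟩ := hpt (insert (g • b) F) (hF.insert _) b
    have h1 : g • z = z := hb z hz1 fun x hx => hz2 x (Or.inr hx)
    have h2 : HasColour t (g • z) (g • b) := (hasColour_smul g).2 hz1
    rw [h1] at h2
    exact hPt (hc.eq (hz2 _ (Or.inl rfl) hne) h2)
  -- points outside `F` are fixed, and these distinguish all points
  have hout : ∀ b ∉ F, g • b = b := fun b hb =>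
    hmove b fun z _ h => hg z fun x hx => h x hx fun e => hb (e ▸ hx)
  refine FaithfulSMul.eq_of_smul_eq_smul (α := M) fun b => ?_
  rw [one_smul]
  refine hmove b fun z h1 h2 => hout z fun hz => ?_
  by_cases hzb : z = b
  · exact hc.ne h1 hzb
  · exact hc.irrefl _ _ (h2 z hz hzb)

/-- A nontrivial automorphism moves a realisation of every type of a point outside a finite set
`X`: otherwise a point `z` with colour `P` to `X ∪ g⁻¹ X` cannot be moved to some `z'`, because the
type has a realisation with colour `t` to `z` and colour `P` to `z'`. -/
theorem movesPoints_of_ne_one (hS : ∀ T ∈ S, IsTriangle T)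
    (hM : Language.IsFraisseLimit (forbC S) M) (hprio : IsPrioritisedClass S R)
    (hcond : MainCondition S R M) {g : M ≃[colourLanguage Λ] M} (hg : g ≠ 1) :
    MovesPoints (fun a b : M => a ≠ b) g := by
  classical
  have hc := isCompleteStructure_limit hM
  obtain ⟨P, t, hPt, hPP, hPt', htP⟩ := exists_neutral_pair hS hM hprio hcond
  intro X hX a₀ ha₀
  by_contra! hfix
  refine hg (eq_one_of_fixes_generic hS hM hPt hPP hPt' htP (F := X ∪ g⁻¹ • X)
    (hX.union hX.smul_set) fun z hz => ?_)
  by_contra hne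
  have hzX : ∀ x ∈ X, HasColour P z x := fun x hx => hz x (Or.inl hx)
  have hz'X : ∀ x ∈ X, HasColour P (g • z) x := fun x hx => by
    have := (hasColour_smul g).2 (hz (g⁻¹ • x) (Or.inr (Set.smul_mem_smul_set hx)))
    rwa [smul_inv_smul] at this
  have hzX' : z ∉ X := fun h => hc.irrefl _ _ (hzX z h)
  have hz'X' : g • z ∉ X := fun h => hc.irrefl _ _ (hz'X _ h)
  have hτ : ∀ x, ∃ p : Λ, x ∈ X → HasColour p a₀ x := by
    intro x
    by_cases hx : x ∈ X
    · obtain ⟨p, hp, -⟩ := hc.existsUnique a₀ x fun e => ha₀ (e ▸ hx)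
      exact ⟨p, fun _ => hp⟩
    · exact ⟨P, fun h => (hx h).elim⟩
  choose τ₀ hτ₀ using hτ
  set τ : M → Λ := fun x => if x = z then t else if x = g • z then P else τ₀ x with hτdef
  have τz : τ z = t := if_pos rfl
  have τz' : τ (g • z) = P := by simp [hτdef, hne]
  have τX : ∀ x ∈ X, τ x = τ₀ x := fun x hx => by
    have h1 : x ≠ z := fun e => hzX' (e ▸ hx)
    have h2 : x ≠ g • z := fun e => hz'X' (e ▸ hx)
    simp [hτdef, h1, h2]
  obtain ⟨d, hd⟩ := exists_point hS hM ((hX.insert (g • z)).insert z) τ (by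
    have hXz : ∀ x ∈ X, ∀ p, HasColour p x z → ¬ IsForbiddenTriangle S (τ x) p (τ z) :=
      fun x hx p hp h => by
        cases hc.eq hp (hc.symm _ _ _ (hzX x hx))
        rw [τz] at h
        exact hPt' _ (h.swap hS)
    have hXz' : ∀ x ∈ X, ∀ p, HasColour p x (g • z) →
        ¬ IsForbiddenTriangle S (τ x) p (τ (g • z)) := fun x hx p hp h => by
      cases hc.eq hp (hc.symm _ _ _ (hz'X x hx))
      rw [τz'] at h
      exact hPP _ (h.swap hS)
    rintro x (rfl | rfl | hx) y (rfl | rfl | hy) p hp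
    · exact (hc.irrefl _ _ hp).elim
    · rw [τz, τz']
      exact htP p
    · exact fun h => hXz y hy p (hc.symm _ _ _ hp) (h.reverse hS)
    · rw [τz, τz']
      exact hPt' p
    · exact (hc.irrefl _ _ hp).elim
    · exact fun h => hXz' y hy p (hc.symm _ _ _ hp) (h.reverse hS)
    · exact hXz x hx p hp
    · exact hXz' x hx p hp
    · rw [τX x hx, τX y hy]
      exact not_isForbiddenTriangle_limit hS hM (hτ₀ x hx) hp (hτ₀ y hy))
  obtain ⟨σ, hσ⟩ := exists_aut hM (hX.insert a₀) (fun x => if x = a₀ then d else x) (by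
    have hXd : ∀ x ∈ X, ∀ p, HasColour p a₀ x → HasColour p d x := fun x hx p hp => by
      rw [hc.eq hp (hτ₀ x hx), ← τX x hx]
      exact hd x (Or.inr (Or.inr hx))
    have hXa : ∀ x ∈ X, x ≠ a₀ := fun x hx e => ha₀ (e ▸ hx)
    rintro x (rfl | hx) y (rfl | hy) p hp
    · exact (hc.irrefl _ _ hp).elim
    · simpa [hXa y hy] using hXd y hy p hp
    · simpa [hXa x hx] using hc.symm _ _ _ (hXd x hx p (hc.symm _ _ _ hp))
    · simpa [hXa x hx, hXa y hy] using hp)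
  have hσa : σ • a₀ = d := by simpa using hσ a₀ (Or.inl rfl)
  have hσX : ∀ x ∈ X, σ • x = x := fun x hx => by
    have hxa : x ≠ a₀ := fun e => ha₀ (e ▸ hx)
    simpa [hxa] using hσ x (Or.inr hx)
  have hgd := hfix σ hσX
  rw [hσa] at hgd
  have h1 : HasColour t (g • d) (g • z) := (hasColour_smul g).2 (τz ▸ hd z (Or.inl rfl))
  rw [← hgd] at h1
  exact hPt (hc.eq (τz' ▸ hd (g • z) (Or.inr (Or.inl rfl))) h1)

end MovedPoints

/-! ### Products of conjugates -/

section ConjugateProducts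

variable {G : Type*} [Group G] {g : G}

/-- `f` is a product of `n` conjugates of `g` and `g⁻¹`. -/
def IsConjProduct (g : G) (n : ℕ) (f : G) : Prop :=
  ∃ l : List G, l.length = n ∧ (∀ x ∈ l, IsConj g x ∨ IsConj g⁻¹ x) ∧ l.prod = f

theorem IsConjProduct.self (g : G) : IsConjProduct g 1 g :=
  ⟨[g], rfl, by rintro x (_ | ⟨_, ⟨⟩⟩); exact Or.inl (IsConj.refl g), by simp⟩

theorem IsConjProduct.mul {n n' : ℕ} {f f' : G} (h : IsConjProduct g n f)
    (h' : IsConjProduct g n' f') : IsConjProduct g (n + n') (f * f') := by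
  obtain ⟨l, hl, hc, rfl⟩ := h
  obtain ⟨l', hl', hc', rfl⟩ := h'
  exact ⟨l ++ l', by simp [hl, hl'], fun x hx => (List.mem_append.1 hx).elim (hc x) (hc' x),
    List.prod_append⟩

theorem IsConjProduct.inv {n : ℕ} {f : G} (h : IsConjProduct g n f) : IsConjProduct g n f⁻¹ := by
  obtain ⟨l, hl, hc, rfl⟩ := h
  refine ⟨(l.map (·⁻¹)).reverse, by simp [hl], fun x hx => ?_, (List.prod_inv_reverse l).symm⟩
  obtain ⟨y, hy, rfl⟩ := List.mem_map.1 (List.mem_reverse.1 hx)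
  rcases hc y hy with h | h
  · obtain ⟨c, rfl⟩ := isConj_iff.1 h
    exact Or.inr (isConj_iff.2 ⟨c, by group⟩)
  · obtain ⟨c, rfl⟩ := isConj_iff.1 h
    exact Or.inl (isConj_iff.2 ⟨c, by group⟩)

theorem IsConjProduct.conj {n : ℕ} {f : G} (h : IsConjProduct g n f) (c : G) :
    IsConjProduct g n (c * f * c⁻¹) := by
  obtain ⟨l, hl, hc, rfl⟩ := h
  refine ⟨l.map (MulAut.conj c), by simp [hl], fun x hx => ?_, ?_⟩
  · obtain ⟨y, hy, rfl⟩ := List.mem_map.1 hx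
    have : IsConj y (MulAut.conj c y) := isConj_iff.2 ⟨c, rfl⟩
    exact (hc y hy).imp (·.trans this) (·.trans this)
  · rw [← map_list_prod, MulAut.conj_apply]

theorem IsConjProduct.commutator {n : ℕ} {f : G} (h : IsConjProduct g n f) (k : G) :
    IsConjProduct g (n + n) (f⁻¹ * (k⁻¹ * f * k)) := by
  simpa using h.inv.mul (h.conj k⁻¹)

theorem IsConjProduct.conjChain {n : ℕ} {f : G} (h : IsConjProduct g n f) (e : Fin 4 → G) :
    IsConjProduct g (n + (n + (n + n))) (conjChain f e 4) := by
  have h4 : _root_.conjChain f e 4 = (e 3 * f * (e 3)⁻¹) * ((e 2 * f * (e 2)⁻¹) *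
    ((e 1 * f * (e 1)⁻¹) * ((e 0 * f * (e 0)⁻¹) * 1))) := rfl
  rw [h4, mul_one]
  exact (h.conj _).mul ((h.conj _).mul ((h.conj _).mul (h.conj _)))

theorem IsConjProduct.exists_fin {n : ℕ} {f : G} (h : IsConjProduct g n f) :
    ∃ k : Fin n → G, (∀ i, IsConj g (k i) ∨ IsConj g⁻¹ (k i)) ∧ f = (List.ofFn k).prod := by
  obtain ⟨l, rfl, hc, rfl⟩ := h
  exact ⟨l.get, fun i => hc _ (List.get_mem l i), by rw [List.ofFn_get]⟩

end ConjugateProducts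

theorem mainTheorem2 {Λ : Type u} [Finite Λ]
    (S : Set (Bundled.{w} (colourLanguage Λ).Structure)) (hS : ∀ T ∈ S, IsTriangle T)
    {m : ℕ} (R : Fin m → Λ) (hprio : IsPrioritisedClass S R)
    (M : Type w) [(colourLanguage Λ).Structure M] [Countable M]
    (hM : FirstOrder.Language.IsFraisseLimit (forbC S) M) (hcond : MainCondition S R M) :
    IsSimpleGroup (M ≃[colourLanguage Λ] M) ∧
      ∀ g : M ≃[colourLanguage Λ] M, g ≠ 1 → ∀ f : M ≃[colourLanguage Λ] M,
        ∃ k : Fin 64 → (M ≃[colourLanguage Λ] M),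
          (∀ i, IsConj g (k i) ∨ IsConj g⁻¹ (k i)) ∧ f = (List.ofFn k).prod := by
  have hI := stationaryIndep_limit hS hM hprio
  have hc := isCompleteStructure_limit hM
  have hG := isClosedAction_aut (Λ := Λ) (M := M)
  let Lp : M → M → Prop := fun a b => ∃ i, HasColour (R i) a b
  have hLsmul : ∀ (g : M ≃[colourLanguage Λ] M) (a b : M), Lp a b → Lp (g • a) (g • b) :=
    fun g a b ⟨i, hi⟩ => ⟨i, (hasColour_smul g).2 hi⟩
  have hLsymm : ∀ a b, Lp a b → Lp b a := fun a b ⟨i, hi⟩ => ⟨i, hc.symm _ _ _ hi⟩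
  have h64 : ∀ g : M ≃[colourLanguage Λ] M, g ≠ 1 → ∀ f, IsConjProduct g 64 f := by
    intro g hg
    obtain ⟨k₁, hk₁⟩ := (movesPoints_of_ne_one hS hM hprio hcond hg).exists_commutator hG hI hLsmul
      hLsymm fun B a c ha hcB h => by
        obtain ⟨-, i, -, -, hi⟩ := ((indep_singleton_iff.1 h).resolve_left ha).resolve_left hcB
        exact ⟨i, hi⟩
    obtain ⟨k₂, hk₂⟩ := hk₁.exists_commutator_movesMaximally hG hI hLsmul hLsymm
      (fun a b ⟨i, hi⟩ => hc.ne hi) hcond.delete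
    have h4 := ((IsConjProduct.self g).commutator k₁).commutator k₂
    -- 32 factors suffice for `f`, and the other 32 are used up by the identity
    have h32 : ∀ f, IsConjProduct g 32 f := fun f => by
      obtain ⟨e, e', rfl⟩ := hk₂.exists_conjChain hG hI f
      exact (h4.conjChain e).mul (h4.conjChain e').inv
    intro f
    simpa using (h32 f).mul (h32 1)
  refine ⟨?_, fun g hg f => (h64 g hg f).exists_fin⟩
  obtain ⟨a⟩ := nonempty_limit hS hM
  obtain ⟨σ, -, hσ⟩ := hI.exist {a} ∅ {a} (Set.finite_singleton a) Set.finite_empty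
    (Set.finite_singleton a)
  have hσ1 : σ ≠ 1 := by
    rintro rfl
    have := hσ a rfl a rfl
    rw [one_smul] at this
    exact hI.mem_of_self _ _ this
  exact
    { exists_pair_ne := ⟨σ, 1, hσ1⟩
      eq_bot_or_eq_top_of_normal := fun N hN => by
        by_cases hbot : N = ⊥
        · exact Or.inl hbot
        obtain ⟨g, hgN, hg⟩ := N.bot_or_exists_ne_one.resolve_left hbot
        refine Or.inr (N.eq_top_iff'.2 fun f => ?_)
        obtain ⟨l, -, hl, rfl⟩ := h64 g hg f
        refine N.list_prod_mem fun x hx => ?_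
        rcases hl x hx with h | h <;> obtain ⟨c, rfl⟩ := isConj_iff.1 h
        · exact hN.conj_mem _ hgN c
        · exact hN.conj_mem _ (N.inv_mem hgN) c }
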